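/- Let $R$ be a commutative ring with $1$ and let $(\mathcal X,\diamond,\mathbf 1)$ be an essentially small $R$-linear symmetric monoidal category (so $\diamond$ is $R$-bilinear on morphisms), with unit isomorphisms $\lambda_x:\mathbf 1\diamond x\to x$ and symmetry $s$. Let $\mathcal F$ be the category of $R$-linear functors $\mathcal X\to R\text{-Mod}$, which is monoidal under Day convolution $$(F\otimes G)(x)=\int^{y,z}\mathcal X(y\diamond z,x)\otimes_R F(y)\otimes_R G(z)$$ with unit $\mathcal X(\mathbf 1,-)$. Let $A$ be a monoid in $\mathcal F$. For an $A$-module (left module object) $M$, write $a\times m\in M(y\diamond z)$ for the product of $a\in A(y)$ and $m\in M(z)$ induced by the action $A\otimes M\to M$; in particular this applies to $M=A$. The commutant of $A$ at $\mathbf 1$ is $$CA(\mathbf 1)=\{b\in A(\mathbf 1)\mid a\times b=A(s_{\mathbf 1,y})(b\times a)\ \text{ for all } y\in\mathcal X,\ a\in A(y)\},$$ where $s_{\mathbf 1,y}:\mathbf 1\diamond y\to y\diamond\mathbf 1$. For $a\in CA(\mathbf 1)$ let $L_a:A\to A$ be the morphism of $A$-modules $b\mapsto A(\lambda_x)(a\times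 b)$ $(b\in A(x))$. Let $n\ge 1$ and $\alpha=(\alpha_1,\dots,\alpha_n)$ with $\alpha_i\in CA(\mathbf 1)$. Let $A\langle\alpha_1,\dots,\alpha_i\rangle$ be the $A$-submodule of $A$ generated by $\alpha_1,\dots,\alpha_i$ (the intersection of all $A$-submodules $N$ of $A$ with $\alpha_1,\dots,\alpha_i\in N(\mathbf 1)$; it is $0$ for $i=0$), and $A\langle\alpha\rangle=A\langle\alpha_1,\dots,\alpha_n\rangle$. The sequence $\alpha$ is called regular if 1. for every $1\le i\le n$, every object $x$ and every $0\ne m\in (A/A\langle\alpha_1,\dots,\alpha_{i-1}\rangle)(x)$, one has $\alpha_i\times m\neq 0$; and 2. $A/A\langle\alpha\rangle\neq 0$. For $p\ge 0$ let $K_p^n(A)=\bigoplus_{S\subseteq\{1,\dots,n\},\,|S|=p}A_S$ with $A_S=A$, so that $K_0^n(A)=A$, and for $p\geq 1$ let $d:K_p^n(A)\to K_{p-1}^n(A)$ be the morphism of $A$-modules whose restriction to the summand $A_S$ with $S=\{i_1<\dots<i_p\}$ is $\sum_{k=1}^p(-1)^{k+1}L_{\alpha_{i_k}}$, the $k$-th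 term taking values in the summand $A_{S\setminus\{i_k\}}$. For $p=1$ write $L_\alpha=d:K_1^n(A)\to A$. **Theorem.** If $\alpha$ is a regular sequence, then the Koszul complex $K_A(\alpha)=(K_\bullet^n(A),d)$ is a resolution of $A/A\langle\alpha\rangle$; that is, the sequence $$0\to K_n^n(A)\xrightarrow{d}\cdots\xrightarrow{d}K_2^n(A)\xrightarrow{d}K_1^n(A)\xrightarrow{L_\alpha}A\to A/A\langle\alpha\rangle\to 0$$ is an exact sequence of $A$-modules. -/

import Mathlib

open CategoryTheory MonoidalCategory

universe w u

/-- The objects of the category `𝓕`: the `R`-linear functors from `X` to `R`-modules. -/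
structure LinFun (R : Type w) [CommRing R] (X : Type u) [Category.{w} X] [Preadditive X]
    [Linear R X] where
  functor : X ⥤ ModuleCat.{w} R
  additive : functor.Additive
  linear : functor.Linear R


noncomputable section

namespace LinFun

section Basic

variable {R : Type w} [CommRing R] {X : Type u} [Category.{w} X] [Preadditive X] [Linear R X]

attribute [instance] LinFun.additive LinFun.linear

/-- Morphisms of `𝓕` are the natural transformations. -/
instance : Category (LinFun R X) :=
  inferInstanceAs (Category (InducedCategory _ LinFun.functor))

/-- The `R`-module `F(x)`. -/
abbrev El (F : LinFun R X) (x : X) : Type w := F.functor.obj x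

/-- The `R`-linear map `F(f) : F(x) → F(y)`. -/
def mp (F : LinFun R X) {x y : X} (f : x ⟶ y) : F.El x →ₗ[R] F.El y := (F.functor.map f).hom

/-- The component at `x` of a morphism of `𝓕`. -/
def ev {F G : LinFun R X} (η : F ⟶ G) (x : X) : F.El x →ₗ[R] G.El x := (η.hom.app x).hom

@[simp] lemma mp_id (F : LinFun R X) (x : X) (a : F.El x) : F.mp (𝟙 x) a = a := by
  simp [mp]

lemma mp_comp (F : LinFun R X) {x y z : X} (f : x ⟶ y) (g : y ⟶ z) (a : F.El x) :
    F.mp (f ≫ g) a = F.mp g (F.mp f a) := by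
  simp [mp]

lemma mp_congr (F : LinFun R X) {x y : X} {f g : x ⟶ y} (h : f = g) (a : F.El x) :
    F.mp f a = F.mp g a := by rw [h]

lemma mp_add (F : LinFun R X) {x y : X} (f g : x ⟶ y) (a : F.El x) :
    F.mp (f + g) a = F.mp f a + F.mp g a := by
  simp [mp, F.functor.map_add]

lemma mp_smul (F : LinFun R X) {x y : X} (r : R) (f : x ⟶ y) (a : F.El x) :
    F.mp (r • f) a = r • F.mp f a := by
  simp [mp, F.functor.map_smul]

lemma ev_mp {F G : LinFun R X} (η : F ⟶ G) {x y : X} (f : x ⟶ y) (a : F.El x) :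
    ev η y (F.mp f a) = G.mp f (ev η x a) :=
  LinearMap.congr_fun (congrArg ModuleCat.Hom.hom (η.hom.naturality f)) a

@[simp] lemma ev_id (F : LinFun R X) (x : X) (a : F.El x) : ev (𝟙 F) x a = a := rfl

@[simp] lemma ev_comp {F G H : LinFun R X} (η : F ⟶ G) (θ : G ⟶ H) (x : X) (a : F.El x) :
    ev (η ≫ θ) x a = ev θ x (ev η x a) := rfl

lemma hom_ext {F G : LinFun R X} {η θ : F ⟶ G} (h : ∀ x a, ev η x a = ev θ x a) : η = θ := by
  apply InducedCategory.hom_ext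
  ext x a
  exact h x a

/-- Build a linear functor from its modules of values and its maps. -/
def ofData (M : X → Type w) [∀ x, AddCommGroup (M x)] [∀ x, Module R (M x)]
    (m : ∀ {x y : X}, (x ⟶ y) → M x →ₗ[R] M y)
    (hid : ∀ x a, m (𝟙 x) a = a)
    (hcomp : ∀ {x y z : X} (f : x ⟶ y) (g : y ⟶ z) (a : M x), m (f ≫ g) a = m g (m f a))
    (hadd : ∀ {x y : X} (f g : x ⟶ y) (a : M x), m (f + g) a = m f a + m g a)
    (hsmul : ∀ {x y : X} (r : R) (f : x ⟶ y) (a : M x), m (r • f) a = r • m f a) :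
    LinFun R X where
  functor :=
    { obj := fun x => ModuleCat.of R (M x)
      map := fun f => ModuleCat.ofHom (m f)
      map_id := fun x => by ext a; exact hid x a
      map_comp := fun f g => by ext a; exact hcomp f g a }
  additive := ⟨fun {x y f g} => by ext a; exact hadd f g a⟩
  linear := ⟨fun {x y} f r => by ext a; exact hsmul r f a⟩

/-- Build a morphism of `𝓕` from its components. -/
def homMk {F G : LinFun R X} (η : ∀ x, F.El x →ₗ[R] G.El x)
    (h : ∀ {x y : X} (f : x ⟶ y) (a : F.El x), η y (F.mp f a) = G.mp f (η x a)) : F ⟶ G :=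
  InducedCategory.homMk
    { app := fun x => ModuleCat.ofHom (η x)
      naturality := fun x y f => by ext a; exact h f a }

@[simp] lemma ev_homMk {F G : LinFun R X} (η : ∀ x, F.El x →ₗ[R] G.El x)
    (h : ∀ {x y : X} (f : x ⟶ y) (a : F.El x), η y (F.mp f a) = G.mp f (η x a)) (x : X) :
    ev (homMk η h) x = η x := rfl

end Basic

/-! ### The tensor product of `𝓕` (Day convolution)

`(F ⊗ G)(x)` is the coend of `X(y ⊗ z, x) ⊗ F(y) ⊗ G(z)` over `y, z`, presented by generators
`(φ, a, b)` with `φ : y ⊗ z ⟶ x`, `a ∈ F(y)`, `b ∈ G(z)` and relations saying that they are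
`R`-trilinear and dinatural in `y` and `z`. -/

section Day

variable {R : Type w} [CommRing R] {X : Type u} [Category.{w} X] [Preadditive X] [Linear R X]
  [MonoidalCategory X]

/-- Generators of `(F ⊗ G)(x)`. -/
structure DayGen (F G : LinFun R X) (x : X) where
  {y z : X}
  φ : y ⊗ z ⟶ x
  a : F.El y
  b : G.El z

/-- Free generators, as elements of the free module. -/
abbrev DayGen.free {F G : LinFun R X} {x y z : X} (φ : y ⊗ z ⟶ x) (a : F.El y) (b : G.El z) :
    DayGen F G x →₀ R := Finsupp.single ⟨φ, a, b⟩ 1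

/-- The relators of `(F ⊗ G)(x)`. -/
inductive DayRel (F G : LinFun R X) (x : X) : (DayGen F G x →₀ R) → Prop
  | hom_add {y z : X} (φ ψ : y ⊗ z ⟶ x) (a : F.El y) (b : G.El z) :
      DayRel F G x (DayGen.free (φ + ψ) a b - (DayGen.free φ a b + DayGen.free ψ a b))
  | hom_smul {y z : X} (r : R) (φ : y ⊗ z ⟶ x) (a : F.El y) (b : G.El z) :
      DayRel F G x (DayGen.free (r • φ) a b - r • DayGen.free φ a b)
  | left_add {y z : X} (φ : y ⊗ z ⟶ x) (a a' : F.El y) (b : G.El z) :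
      DayRel F G x (DayGen.free φ (a + a') b - (DayGen.free φ a b + DayGen.free φ a' b))
  | left_smul {y z : X} (r : R) (φ : y ⊗ z ⟶ x) (a : F.El y) (b : G.El z) :
      DayRel F G x (DayGen.free φ (r • a) b - r • DayGen.free φ a b)
  | right_add {y z : X} (φ : y ⊗ z ⟶ x) (a : F.El y) (b b' : G.El z) :
      DayRel F G x (DayGen.free φ a (b + b') - (DayGen.free φ a b + DayGen.free φ a b'))
  | right_smul {y z : X} (r : R) (φ : y ⊗ z ⟶ x) (a : F.El y) (b : G.El z) :
      DayRel F G x (DayGen.free φ a (r • b) - r • DayGen.free φ a b)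
  | dinat {y z y' z' : X} (f : y ⟶ y') (g : z ⟶ z') (φ : y' ⊗ z' ⟶ x) (a : F.El y)
      (b : G.El z) :
      DayRel F G x (DayGen.free φ (F.mp f a) (G.mp g b) - DayGen.free ((f ⊗ₘ g) ≫ φ) a b)

/-- The coend, in a possibly larger universe. -/
abbrev DayPre (F G : LinFun R X) (x : X) : Type (max u w) :=
  (DayGen F G x →₀ R) ⧸ Submodule.span R {r | DayRel F G x r}

lemma DayPre.rel {F G : LinFun R X} {x : X} {s t : DayGen F G x →₀ R} (h : DayRel F G x (s - t)) :
    (Submodule.Quotient.mk s : DayPre F G x) = Submodule.Quotient.mk t :=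
  (Submodule.Quotient.eq _).2 (Submodule.subset_span h)

variable [EssentiallySmall.{w} X]

instance (F G : LinFun R X) (x : X) : Small.{w} (DayPre F G x) := by
  let e := (equivSmallModel.{w} X).inverse
  let c := (equivSmallModel.{w} X).functor
  let J : Type w := Σ (y z : SmallModel.{w} X), (e.obj y ⊗ e.obj z ⟶ x) × F.El (e.obj y) ×
    G.El (e.obj z)
  let k : J → DayGen F G x := fun j => ⟨j.2.2.1, j.2.2.2.1, j.2.2.2.2⟩
  let q : (J →₀ R) →ₗ[R] DayPre F G x :=
    (Submodule.mkQ _).comp (Finsupp.lmapDomain R R k)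
  have hq : Function.Surjective q := by
    rw [← LinearMap.range_eq_top, eq_top_iff]
    rintro t -
    obtain ⟨t, rfl⟩ := Submodule.Quotient.mk_surjective _ t
    induction t using Finsupp.induction_linear with
    | zero => exact Submodule.zero_mem _
    | add s t hs ht => exact Submodule.add_mem _ hs ht
    | single g r =>
      obtain ⟨φ, a, b⟩ := g
      rename_i y z
      rw [show (Finsupp.single (⟨φ, a, b⟩ : DayGen F G x) r) = r • DayGen.free φ a b by simp]
      rw [Submodule.Quotient.mk_smul]
      refine Submodule.smul_mem (LinearMap.range q) r ?_
      let i : ∀ v : X, v ≅ e.obj (c.obj v) := fun v => (equivSmallModel.{w} X).unitIso.app v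
      refine ⟨Finsupp.single ⟨c.obj y, c.obj z, ((i y).inv ⊗ₘ (i z).inv) ≫ φ,
        F.mp (i y).hom a, G.mp (i z).hom b⟩ 1, ?_⟩
      have h := DayPre.rel (DayRel.dinat (i y).hom (i z).hom (((i y).inv ⊗ₘ (i z).inv) ≫ φ) a b)
      rw [← Category.assoc, tensorHom_comp_tensorHom] at h
      simp only [Iso.hom_inv_id, id_tensorHom_id, Category.id_comp] at h
      rw [← h]
      simp [q, k]
  exact small_of_surjective hq

/-- The module `(F ⊗ G)(x)`. -/
def DayEl (F G : LinFun R X) (x : X) : Type w := Shrink.{w} (DayPre F G x)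

instance (F G : LinFun R X) (x : X) : AddCommGroup (DayEl F G x) :=
  inferInstanceAs (AddCommGroup (Shrink.{w} (DayPre F G x)))

instance (F G : LinFun R X) (x : X) : Module R (DayEl F G x) :=
  inferInstanceAs (Module R (Shrink.{w} (DayPre F G x)))

/-- The two universe sizes of the coend are isomorphic modules. -/
def dayElEquiv (F G : LinFun R X) (x : X) : DayEl F G x ≃ₗ[R] DayPre F G x :=
  Shrink.linearEquiv R (DayPre F G x)

/-- The class of the generator `(φ, a, b)` in `(F ⊗ G)(x)`. -/
def dmk {F G : LinFun R X} {x y z : X} (φ : y ⊗ z ⟶ x) (a : F.El y) (b : G.El z) : DayEl F G x :=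
  (dayElEquiv F G x).symm (Submodule.Quotient.mk (DayGen.free φ a b))

section

variable {F G : LinFun R X} {x y z : X}

lemma dmk_hom_add (φ ψ : y ⊗ z ⟶ x) (a : F.El y) (b : G.El z) :
    dmk (φ + ψ) a b = dmk φ a b + dmk ψ a b := by
  simp only [dmk]
  rw [DayPre.rel (DayRel.hom_add φ ψ a b), Submodule.Quotient.mk_add, map_add]

lemma dmk_hom_smul (r : R) (φ : y ⊗ z ⟶ x) (a : F.El y) (b : G.El z) :
    dmk (r • φ) a b = r • dmk φ a b := by
  simp only [dmk]
  rw [DayPre.rel (DayRel.hom_smul r φ a b), Submodule.Quotient.mk_smul, map_smul]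

lemma dmk_left_add (φ : y ⊗ z ⟶ x) (a a' : F.El y) (b : G.El z) :
    dmk φ (a + a') b = dmk φ a b + dmk φ a' b := by
  simp only [dmk]
  rw [DayPre.rel (DayRel.left_add φ a a' b), Submodule.Quotient.mk_add, map_add]

lemma dmk_left_smul (r : R) (φ : y ⊗ z ⟶ x) (a : F.El y) (b : G.El z) :
    dmk φ (r • a) b = r • dmk φ a b := by
  simp only [dmk]
  rw [DayPre.rel (DayRel.left_smul r φ a b), Submodule.Quotient.mk_smul, map_smul]

lemma dmk_right_add (φ : y ⊗ z ⟶ x) (a : F.El y) (b b' : G.El z) :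
    dmk φ a (b + b') = dmk φ a b + dmk φ a b' := by
  simp only [dmk]
  rw [DayPre.rel (DayRel.right_add φ a b b'), Submodule.Quotient.mk_add, map_add]

lemma dmk_right_smul (r : R) (φ : y ⊗ z ⟶ x) (a : F.El y) (b : G.El z) :
    dmk φ a (r • b) = r • dmk φ a b := by
  simp only [dmk]
  rw [DayPre.rel (DayRel.right_smul r φ a b), Submodule.Quotient.mk_smul, map_smul]

lemma dmk_dinat {y' z' : X} (f : y ⟶ y') (g : z ⟶ z') (φ : y' ⊗ z' ⟶ x) (a : F.El y)
    (b : G.El z) : dmk φ (F.mp f a) (G.mp g b) = dmk ((f ⊗ₘ g) ≫ φ) a b := by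
  simp only [dmk]
  rw [DayPre.rel (DayRel.dinat f g φ a b)]

lemma dayEl_ext {N : Type*} [AddCommGroup N] [Module R N] {p q : DayEl F G x →ₗ[R] N}
    (h : ∀ (y z : X) (φ : y ⊗ z ⟶ x) (a : F.El y) (b : G.El z), p (dmk φ a b) = q (dmk φ a b)) :
    p = q := by
  have : p.comp (dayElEquiv F G x).symm.toLinearMap =
      q.comp (dayElEquiv F G x).symm.toLinearMap := by
    apply Submodule.linearMap_qext
    apply Finsupp.lhom_ext'
    rintro ⟨φ, a, b⟩
    ext
    exact h _ _ φ a b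
  ext t
  obtain ⟨t, rfl⟩ := (dayElEquiv F G x).symm.surjective t
  exact LinearMap.congr_fun this t

/-- Linear maps out of `(F ⊗ G)(x)`. -/
def dayElLift {N : Type*} [AddCommGroup N] [Module R N]
    (p : ∀ (y z : X), (y ⊗ z ⟶ x) → F.El y → G.El z → N)
    (hom_add : ∀ y z φ ψ a b, p y z (φ + ψ) a b = p y z φ a b + p y z ψ a b)
    (hom_smul : ∀ y z (r : R) φ a b, p y z (r • φ) a b = r • p y z φ a b)
    (left_add : ∀ y z φ a a' b, p y z φ (a + a') b = p y z φ a b + p y z φ a' b)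
    (left_smul : ∀ y z (r : R) φ a b, p y z φ (r • a) b = r • p y z φ a b)
    (right_add : ∀ y z φ a b b', p y z φ a (b + b') = p y z φ a b + p y z φ a b')
    (right_smul : ∀ y z (r : R) φ a b, p y z φ a (r • b) = r • p y z φ a b)
    (dinat : ∀ y z y' z' (f : y ⟶ y') (g : z ⟶ z') φ a b,
      p y' z' φ (F.mp f a) (G.mp g b) = p y z ((f ⊗ₘ g) ≫ φ) a b) :
    DayEl F G x →ₗ[R] N :=
  (Submodule.liftQ _ (Finsupp.lift N R (DayGen F G x) (fun g => p g.y g.z g.φ g.a g.b)) (by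
    rw [Submodule.span_le]
    rintro r hr
    have hs : ∀ {y z : X} (φ : y ⊗ z ⟶ x) (a : F.El y) (b : G.El z),
        Finsupp.lift N R (DayGen F G x) (fun g => p g.y g.z g.φ g.a g.b) (DayGen.free φ a b) =
          p y z φ a b := by
      intro y z φ a b
      simp
    rw [SetLike.mem_coe, LinearMap.mem_ker]
    cases hr with
    | hom_add φ ψ a b => simp only [map_sub, map_add, hs, hom_add, sub_self]
    | hom_smul r φ a b => simp only [map_sub, map_smul, hs, hom_smul, sub_self]
    | left_add φ a a' b => simp only [map_sub, map_add, hs, left_add, sub_self]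
    | left_smul r φ a b => simp only [map_sub, map_smul, hs, left_smul, sub_self]
    | right_add φ a b b' => simp only [map_sub, map_add, hs, right_add, sub_self]
    | right_smul r φ a b => simp only [map_sub, map_smul, hs, right_smul, sub_self]
    | dinat f g φ a b => simp only [map_sub, hs, dinat, sub_self])).comp
    (dayElEquiv F G x).toLinearMap

@[simp] lemma dayElLift_dmk {N : Type*} [AddCommGroup N] [Module R N]
    (p : ∀ (y z : X), (y ⊗ z ⟶ x) → F.El y → G.El z → N) (h₁ h₂ h₃ h₄ h₅ h₆ h₇)
    (y z : X) (φ : y ⊗ z ⟶ x) (a : F.El y) (b : G.El z) :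
    dayElLift p h₁ h₂ h₃ h₄ h₅ h₆ h₇ (dmk φ a b) = p y z φ a b := by
  simp [dayElLift, dmk]

end

/-- The functoriality of `(F ⊗ G)(x)` in `x`: it sends `(φ, a, b)` to `(φ ≫ h, a, b)`. -/
def dayMap (F G : LinFun R X) {x x' : X} (h : x ⟶ x') : DayEl F G x →ₗ[R] DayEl F G x' :=
  dayElLift (fun _ _ φ a b => dmk (φ ≫ h) a b)
    (by intros; rw [Preadditive.add_comp, dmk_hom_add])
    (by intros; rw [Linear.smul_comp, dmk_hom_smul])
    (by intros; rw [dmk_left_add]) (by intros; rw [dmk_left_smul])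
    (by intros; rw [dmk_right_add]) (by intros; rw [dmk_right_smul])
    (by intros; rw [dmk_dinat, Category.assoc])

@[simp] lemma dayMap_dmk {F G : LinFun R X} {x x' y z : X} (h : x ⟶ x') (φ : y ⊗ z ⟶ x)
    (a : F.El y) (b : G.El z) : dayMap F G h (dmk φ a b) = dmk (φ ≫ h) a b :=
  dayElLift_dmk _ _ _ _ _ _ _ _ _ _ _ _ _

/-- The functor `F ⊗ G`. -/
def day (F G : LinFun R X) : LinFun R X :=
  ofData (DayEl F G) (fun h => dayMap F G h)
    (fun x => LinearMap.congr_fun (f := dayMap F G (𝟙 x)) (g := LinearMap.id)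
      (dayEl_ext (by intros; simp)))
    (fun f g => LinearMap.congr_fun (f := dayMap F G (f ≫ g))
      (g := (dayMap F G g).comp (dayMap F G f)) (dayEl_ext (by intros; simp)))
    (fun f g => LinearMap.congr_fun (f := dayMap F G (f + g)) (g := dayMap F G f + dayMap F G g)
      (dayEl_ext (by intros; simp [Preadditive.comp_add, dmk_hom_add])))
    (fun r f => LinearMap.congr_fun (f := dayMap F G (r • f)) (g := r • dayMap F G f)
      (dayEl_ext (by intros; simp [Linear.comp_smul, dmk_hom_smul])))

/-- The universal pairing `F(y) × G(z) → (F ⊗ G)(y ⊗ z)`. -/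
def pr {F G : LinFun R X} {y z : X} (a : F.El y) (b : G.El z) : (day F G).El (y ⊗ z) :=
  dmk (𝟙 (y ⊗ z)) a b

section

variable {F G H : LinFun R X}

lemma mp_pr {x y z : X} (φ : y ⊗ z ⟶ x) (a : F.El y) (b : G.El z) :
    (day F G).mp φ (pr a b) = dmk φ a b := by
  have : dayMap F G φ (dmk (𝟙 (y ⊗ z)) a b) = dmk φ a b := by simp
  exact this

lemma pr_mp {y z y' z' : X} (f : y ⟶ y') (g : z ⟶ z') (a : F.El y) (b : G.El z) :
    (pr (F.mp f a) (G.mp g b) : (day F G).El _) = (day F G).mp (f ⊗ₘ g) (pr a b) := by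
  rw [mp_pr, pr, dmk_dinat, Category.comp_id]

lemma pr_mp_left {y z y' : X} (f : y ⟶ y') (a : F.El y) (b : G.El z) :
    (pr (F.mp f a) b : (day F G).El _) = (day F G).mp (f ▷ z) (pr a b) := by
  have := pr_mp f (𝟙 z) a b
  rwa [mp_id, tensorHom_id] at this

lemma pr_mp_right {y z z' : X} (g : z ⟶ z') (a : F.El y) (b : G.El z) :
    (pr a (G.mp g b) : (day F G).El _) = (day F G).mp (y ◁ g) (pr a b) := by
  have := pr_mp (𝟙 y) g a b
  rwa [mp_id, id_tensorHom] at this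

lemma pr_add_left {y z : X} (a a' : F.El y) (b : G.El z) :
    (pr (a + a') b : (day F G).El _) = pr a b + pr a' b := dmk_left_add _ _ _ _

lemma pr_smul_left {y z : X} (r : R) (a : F.El y) (b : G.El z) :
    (pr (r • a) b : (day F G).El _) = r • pr a b := dmk_left_smul _ _ _ _

lemma pr_add_right {y z : X} (a : F.El y) (b b' : G.El z) :
    (pr a (b + b') : (day F G).El _) = pr a b + pr a b' := dmk_right_add _ _ _ _

lemma pr_smul_right {y z : X} (r : R) (a : F.El y) (b : G.El z) :
    (pr a (r • b) : (day F G).El _) = r • pr a b := dmk_right_smul _ _ _ _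

lemma day_hom_ext {η θ : day F G ⟶ H}
    (h : ∀ (y z : X) (a : F.El y) (b : G.El z), ev η _ (pr a b) = ev θ _ (pr a b)) : η = θ := by
  apply hom_ext
  intro x
  refine LinearMap.congr_fun (dayEl_ext ?_)
  intro y z φ a b
  rw [← mp_pr]
  erw [ev_mp, ev_mp, h]

/-- The component at `x` of `dayLift` below: it sends `(φ, a, b)` to `H(φ)(p(a, b))`. -/
def dayLiftEl (p : ∀ (y z : X), F.El y → G.El z → H.El (y ⊗ z))
    (left_add : ∀ y z a a' b, p y z (a + a') b = p y z a b + p y z a' b)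
    (left_smul : ∀ y z (r : R) a b, p y z (r • a) b = r • p y z a b)
    (right_add : ∀ y z a b b', p y z a (b + b') = p y z a b + p y z a b')
    (right_smul : ∀ y z (r : R) a b, p y z a (r • b) = r • p y z a b)
    (nat : ∀ y z y' z' (f : y ⟶ y') (g : z ⟶ z') a b,
      p y' z' (F.mp f a) (G.mp g b) = H.mp (f ⊗ₘ g) (p y z a b)) (x : X) :
    DayEl F G x →ₗ[R] H.El x :=
  dayElLift (fun y z φ a b => H.mp φ (p y z a b))
    (by intros; rw [mp_add]) (by intros; rw [mp_smul])
    (by intros; rw [left_add, map_add]) (by intros; rw [left_smul, map_smul])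
    (by intros; rw [right_add, map_add]) (by intros; rw [right_smul, map_smul])
    (by intros; rw [nat, mp_comp])

@[simp] lemma dayLiftEl_dmk (p : ∀ (y z : X), F.El y → G.El z → H.El (y ⊗ z)) (h₁ h₂ h₃ h₄ h₅)
    (x y z : X) (φ : y ⊗ z ⟶ x) (a : F.El y) (b : G.El z) :
    dayLiftEl p h₁ h₂ h₃ h₄ h₅ x (dmk φ a b) = H.mp φ (p y z a b) := by
  simp [dayLiftEl]

/-- The universal property: natural bilinear pairings `F(y) × G(z) → H(y ⊗ z)` give morphisms
`F ⊗ G ⟶ H`. -/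
def dayLift (p : ∀ (y z : X), F.El y → G.El z → H.El (y ⊗ z))
    (left_add : ∀ y z a a' b, p y z (a + a') b = p y z a b + p y z a' b)
    (left_smul : ∀ y z (r : R) a b, p y z (r • a) b = r • p y z a b)
    (right_add : ∀ y z a b b', p y z a (b + b') = p y z a b + p y z a b')
    (right_smul : ∀ y z (r : R) a b, p y z a (r • b) = r • p y z a b)
    (nat : ∀ y z y' z' (f : y ⟶ y') (g : z ⟶ z') a b,
      p y' z' (F.mp f a) (G.mp g b) = H.mp (f ⊗ₘ g) (p y z a b)) : day F G ⟶ H :=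
  homMk (dayLiftEl p left_add left_smul right_add right_smul nat)
    (fun {x x'} f => LinearMap.congr_fun
      (f := (dayLiftEl p left_add left_smul right_add right_smul nat x').comp (dayMap F G f))
      (g := (H.mp f).comp (dayLiftEl p left_add left_smul right_add right_smul nat x))
      (dayEl_ext (by
        intro y z φ a b
        simp [mp_comp])))

@[simp] lemma dayLift_pr (p : ∀ (y z : X), F.El y → G.El z → H.El (y ⊗ z)) (h₁ h₂ h₃ h₄ h₅)
    (y z : X) (a : F.El y) (b : G.El z) :
    ev (dayLift p h₁ h₂ h₃ h₄ h₅) (y ⊗ z) (pr a b) = p y z a b := by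
  have : dayLiftEl p h₁ h₂ h₃ h₄ h₅ (y ⊗ z) (dmk (𝟙 (y ⊗ z)) a b) = p y z a b := by simp
  exact this

end

lemma day_induction {F G : LinFun R X} {x : X} {P : (day F G).El x → Prop} (zero : P 0)
    (add : ∀ s t, P s → P t → P (s + t))
    (pure : ∀ (y z : X) (φ : y ⊗ z ⟶ x) (a : F.El y) (b : G.El z), P ((day F G).mp φ (pr a b)))
    (t : (day F G).El x) : P t := by
  obtain ⟨t, rfl⟩ := (dayElEquiv F G x).symm.surjective t
  obtain ⟨t, rfl⟩ := Submodule.Quotient.mk_surjective _ t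
  induction t using Finsupp.induction_linear with
  | zero => rw [Submodule.Quotient.mk_zero, map_zero]; exact zero
  | add s t hs ht =>
    rw [Submodule.Quotient.mk_add, map_add]
    exact add _ _ hs ht
  | single g r =>
    obtain ⟨φ, a, b⟩ := g
    have h := pure _ _ φ (r • a) b
    rw [mp_pr, dmk_left_smul] at h
    rw [show (Finsupp.single (⟨φ, a, b⟩ : DayGen F G x) r) = r • DayGen.free φ a b by simp,
      Submodule.Quotient.mk_smul, map_smul]
    exact h

/-- The universal pairing as a bilinear map. -/
def prLin (F G : LinFun R X) (y z : X) : F.El y →ₗ[R] G.El z →ₗ[R] (day F G).El (y ⊗ z) :=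
  LinearMap.mk₂ R pr pr_add_left pr_smul_left pr_add_right pr_smul_right

lemma pr_zero_left {F G : LinFun R X} {y z : X} (b : G.El z) :
    (pr (0 : F.El y) b : (day F G).El _) = 0 := (prLin F G y z).map_zero₂ b

lemma pr_zero_right {F G : LinFun R X} {y z : X} (a : F.El y) :
    (pr a (0 : G.El z) : (day F G).El _) = 0 := (prLin F G y z a).map_zero

section Structure

/-- The action of the tensor product on morphisms. -/
def dayHom {F F' G G' : LinFun R X} (η : F ⟶ F') (θ : G ⟶ G') : day F G ⟶ day F' G' :=
  dayLift (fun y z a b => pr (ev η y a) (ev θ z b))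
    (by intros; rw [map_add, pr_add_left]) (by intros; rw [map_smul, pr_smul_left])
    (by intros; rw [map_add, pr_add_right]) (by intros; rw [map_smul, pr_smul_right])
    (by intros; rw [ev_mp, ev_mp, pr_mp])

@[simp] lemma dayHom_pr {F F' G G' : LinFun R X} (η : F ⟶ F') (θ : G ⟶ G') {y z : X}
    (a : F.El y) (b : G.El z) :
    ev (dayHom η θ) (y ⊗ z) (pr a b) = pr (ev η y a) (ev θ z b) :=
  dayLift_pr _ _ _ _ _ _ _ _ _ _

variable [MonoidalPreadditive X] [MonoidalLinear R X]

/-- The functor `x ↦ H(x ⊗ z)`. -/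
def shiftRight (H : LinFun R X) (z : X) : LinFun R X :=
  ofData (fun x => H.El (x ⊗ z)) (fun f => H.mp (f ▷ z))
    (by intros; rw [id_whiskerRight, mp_id])
    (by intros; rw [comp_whiskerRight, mp_comp])
    (by intros; rw [MonoidalPreadditive.add_whiskerRight, mp_add])
    (by intros; rw [MonoidalLinear.smul_whiskerRight, mp_smul])

/-- The functor `x ↦ H(y ⊗ x)`. -/
def shiftLeft (H : LinFun R X) (y : X) : LinFun R X :=
  ofData (fun x => H.El (y ⊗ x)) (fun f => H.mp (y ◁ f))
    (by intros; rw [whiskerLeft_id, mp_id])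
    (by intros; rw [whiskerLeft_comp, mp_comp])
    (by intros; rw [MonoidalPreadditive.whiskerLeft_add, mp_add])
    (by intros; rw [MonoidalLinear.whiskerLeft_smul, mp_smul])

/-- For `c ∈ H(z)`, the map `a ⊗ b ↦ a ⊗ (b ⊗ c)`. -/
def assocHomAux (F G : LinFun R X) {H : LinFun R X} {z : X} (c : H.El z) :
    day F G ⟶ shiftRight (day F (day G H)) z :=
  dayLift (H := shiftRight (day F (day G H)) z)
    (fun y₁ y₂ a b => (day F (day G H)).mp (α_ y₁ y₂ z).inv (pr a (pr b c)))
    (by intros; rw [pr_add_left, map_add]; rfl) (by intros; rw [pr_smul_left, map_smul]; rfl)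
    (by intros; rw [pr_add_left, pr_add_right, map_add]; rfl)
    (by intros; rw [pr_smul_left, pr_smul_right, map_smul]; rfl)
    (by
      intro y₁ y₂ y₁' y₂' f g a b
      change _ = (day F (day G H)).mp ((f ⊗ₘ g) ▷ z) _
      rw [pr_mp_left (F := G) (G := H), pr_mp, ← mp_comp, ← mp_comp]
      refine mp_congr _ ?_ _
      simp [MonoidalCategory.tensorHom_def])

lemma assocHomAux_pr (F G : LinFun R X) {H : LinFun R X} {z y₁ y₂ : X} (c : H.El z)
    (a : F.El y₁) (b : G.El y₂) :
    ev (assocHomAux F G c) _ (pr a b) =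
      (day F (day G H)).mp (α_ y₁ y₂ z).inv (pr a (pr b c)) :=
  dayLift_pr _ _ _ _ _ _ _ _ _ _

/-- For `a ∈ F(y)`, the map `b ⊗ c ↦ (a ⊗ b) ⊗ c`. -/
def assocInvAux {F : LinFun R X} (G H : LinFun R X) {y : X} (a : F.El y) :
    day G H ⟶ shiftLeft (day (day F G) H) y :=
  dayLift (H := shiftLeft (day (day F G) H) y)
    (fun z₁ z₂ b c => (day (day F G) H).mp (α_ y z₁ z₂).hom (pr (pr a b) c))
    (by intros; rw [pr_add_right, pr_add_left, map_add]; rfl)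
    (by intros; rw [pr_smul_right, pr_smul_left, map_smul]; rfl)
    (by intros; rw [pr_add_right, map_add]; rfl)
    (by intros; rw [pr_smul_right, map_smul]; rfl)
    (by
      intro y₁ y₂ y₁' y₂' f g b c
      change _ = (day (day F G) H).mp (y ◁ (f ⊗ₘ g)) _
      rw [pr_mp_right (F := F) (G := G), pr_mp, ← mp_comp, ← mp_comp]
      refine mp_congr _ ?_ _
      simp [MonoidalCategory.tensorHom_def])

lemma assocInvAux_pr {F : LinFun R X} (G H : LinFun R X) {y z₁ z₂ : X} (a : F.El y)
    (b : G.El z₁) (c : H.El z₂) :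
    ev (assocInvAux G H a) _ (pr b c) =
      (day (day F G) H).mp (α_ y z₁ z₂).hom (pr (pr a b) c) :=
  dayLift_pr _ _ _ _ _ _ _ _ _ _

/-- The associator. -/
def assocHom (F G H : LinFun R X) : day (day F G) H ⟶ day F (day G H) :=
  dayLift (fun y z t c => ev (assocHomAux F G c) y t)
    (by intros; rw [map_add]; rfl) (by intros; rw [map_smul]; rfl)
    (by
      intro y z t c c'
      induction t using day_induction with
      | zero => simp only [map_zero]; exact (add_zero _).symm
      | add s t hs ht => simp only [map_add, hs, ht]; exact add_add_add_comm _ _ _ _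
      | pure y₁ y₂ φ a b =>
        simp only [ev_mp, assocHomAux_pr]
        rw [pr_add_right, pr_add_right, map_add]
        exact map_add ((shiftRight (day F (day G H)) z).mp φ) _ _)
    (by
      intro y z r t c
      induction t using day_induction with
      | zero => simp only [map_zero]; change _ = r • (0 : (day F (day G H)).El _); rw [smul_zero]; rfl
      | add s t hs ht => simp only [map_add, hs, ht]; exact (smul_add _ _ _).symm
      | pure y₁ y₂ φ a b =>
        simp only [ev_mp, assocHomAux_pr]
        rw [pr_smul_right, pr_smul_right, map_smul]
        exact map_smul ((shiftRight (day F (day G H)) z).mp φ) _ _)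
    (by
      intro y z y' z' f g t c
      induction t using day_induction with
      | zero => simp only [map_zero]; exact (map_zero _).symm
      | add s t hs ht => simp only [map_add, hs, ht]; exact (map_add _ _ _).symm
      | pure y₁ y₂ φ a b =>
        simp only [ev_mp, assocHomAux_pr]
        change (day F (day G H)).mp (f ▷ z') ((day F (day G H)).mp (φ ▷ z') _) =
          (day F (day G H)).mp (f ⊗ₘ g) ((day F (day G H)).mp (φ ▷ z) _)
        rw [pr_mp_right, pr_mp_right]
        simp only [← mp_comp]
        refine mp_congr _ ?_ _
        simp only [Category.assoc]
        rw [MonoidalCategory.tensorHom_def, ← whisker_exchange, ← whisker_exchange_assoc]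
        simp)

/-- The inverse of the associator. -/
def assocInv (F G H : LinFun R X) : day F (day G H) ⟶ day (day F G) H :=
  dayLift (fun y z a t => ev (assocInvAux G H a) z t)
    (by
      intro y z a a' t
      induction t using day_induction with
      | zero => simp only [map_zero]; exact (add_zero _).symm
      | add s t hs ht => simp only [map_add, hs, ht]; exact add_add_add_comm _ _ _ _
      | pure y₁ y₂ φ b c =>
        simp only [ev_mp, assocInvAux_pr]
        rw [pr_add_left, pr_add_left, map_add]
        exact map_add ((shiftLeft (day (day F G) H) y).mp φ) _ _)
    (by
      intro y z r a t
      induction t using day_induction with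
      | zero => simp only [map_zero]; change _ = r • (0 : (day (day F G) H).El _); rw [smul_zero]; rfl
      | add s t hs ht => simp only [map_add, hs, ht]; exact (smul_add _ _ _).symm
      | pure y₁ y₂ φ b c =>
        simp only [ev_mp, assocInvAux_pr]
        rw [pr_smul_left, pr_smul_left, map_smul]
        exact map_smul ((shiftLeft (day (day F G) H) y).mp φ) _ _)
    (by intros; rw [map_add]; rfl) (by intros; rw [map_smul]; rfl)
    (by
      intro y z y' z' f g a t
      induction t using day_induction with
      | zero => simp only [map_zero]; exact (map_zero _).symm
      | add s t hs ht => simp only [map_add, hs, ht]; exact (map_add _ _ _).symm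
      | pure y₁ y₂ φ b c =>
        simp only [ev_mp, assocInvAux_pr]
        change (day (day F G) H).mp (y' ◁ g) ((day (day F G) H).mp (y' ◁ φ) _) =
          (day (day F G) H).mp (f ⊗ₘ g) ((day (day F G) H).mp (y ◁ φ) _)
        rw [pr_mp_left, pr_mp_left]
        simp only [← mp_comp]
        refine mp_congr _ ?_ _
        simp only [Category.assoc]
        rw [MonoidalCategory.tensorHom_def', whisker_exchange, whisker_exchange_assoc]
        simp)

@[simp] lemma assocHom_pr (F G H : LinFun R X) {x y z : X} (a : F.El x) (b : G.El y)
    (c : H.El z) :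
    ev (assocHom F G H) _ (pr (pr a b) c) =
      (day F (day G H)).mp (α_ x y z).inv (pr a (pr b c)) := by
  have : ev (assocHom F G H) _ (pr (pr a b) c) = ev (assocHomAux F G c) _ (pr a b) :=
    dayLift_pr _ _ _ _ _ _ _ _ _ _
  rw [this, assocHomAux_pr]

@[simp] lemma assocInv_pr (F G H : LinFun R X) {x y z : X} (a : F.El x) (b : G.El y)
    (c : H.El z) :
    ev (assocInv F G H) _ (pr a (pr b c)) =
      (day (day F G) H).mp (α_ x y z).hom (pr (pr a b) c) := by
  have : ev (assocInv F G H) _ (pr a (pr b c)) = ev (assocInvAux G H a) _ (pr b c) :=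
    dayLift_pr _ _ _ _ _ _ _ _ _ _
  rw [this, assocInvAux_pr]

lemma day_hom_ext_left {F G H K : LinFun R X} {η θ : day (day F G) H ⟶ K}
    (h : ∀ (x y z : X) (a : F.El x) (b : G.El y) (c : H.El z),
      ev η _ (pr (pr a b) c) = ev θ _ (pr (pr a b) c)) : η = θ := by
  apply day_hom_ext
  intro y z t c
  induction t using day_induction with
  | zero => simp only [pr_zero_left, map_zero]
  | add s t hs ht => simp only [pr_add_left, map_add, hs, ht]
  | pure y₁ y₂ φ a b => simp only [pr_mp_left, ev_mp, h]

lemma day_hom_ext_right {F G H K : LinFun R X} {η θ : day F (day G H) ⟶ K}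
    (h : ∀ (x y z : X) (a : F.El x) (b : G.El y) (c : H.El z),
      ev η _ (pr a (pr b c)) = ev θ _ (pr a (pr b c))) : η = θ := by
  apply day_hom_ext
  intro y z a t
  induction t using day_induction with
  | zero => simp only [pr_zero_right, map_zero]
  | add s t hs ht => simp only [pr_add_right, map_add, hs, ht]
  | pure y₁ y₂ φ b c => simp only [pr_mp_right, ev_mp, h]

variable (R X) in
/-- The unit object `X(𝟙, -)` of `𝓕`. -/
def dayUnit : LinFun R X where
  functor := (linearCoyoneda R X).obj (Opposite.op (𝟙_ X))
  additive := inferInstance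
  linear := ⟨fun f r => by ext g; exact Linear.comp_smul _ _ _ _ _ _⟩

/-- The values of the unit object. -/
def unitEl (x : X) : (dayUnit R X).El x ≃ₗ[R] (𝟙_ X ⟶ x) := LinearEquiv.refl R (𝟙_ X ⟶ x)

lemma unitEl_mp {x y : X} (f : x ⟶ y) (u : (dayUnit R X).El x) :
    unitEl y ((dayUnit R X).mp f u) = unitEl x u ≫ f := rfl

variable (R X) in
/-- The identity of `𝟙`, as an element of the unit object. -/
def unitOne : (dayUnit R X).El (𝟙_ X) := (unitEl (𝟙_ X)).symm (𝟙 (𝟙_ X))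

@[simp] lemma unitEl_unitOne : unitEl (𝟙_ X) (unitOne R X) = 𝟙 (𝟙_ X) := rfl

lemma mp_unitOne {x : X} (u : (dayUnit R X).El x) :
    (dayUnit R X).mp (unitEl x u) (unitOne R X) = u := by
  apply (unitEl x).injective
  rw [unitEl_mp, unitEl_unitOne, Category.id_comp]

/-- The left unitor `u ⊗ b ↦ F((u ⊗ z) ∘ λ⁻¹)(b)`. -/
def leftUnitHom (F : LinFun R X) : day (dayUnit R X) F ⟶ F :=
  dayLift (fun y z u b => F.mp ((λ_ z).inv ≫ unitEl y u ▷ z) b)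
    (by
      intro y z u v b
      rw [map_add, MonoidalPreadditive.add_whiskerRight, Preadditive.comp_add, mp_add])
    (by
      intro y z r u b
      rw [map_smul, MonoidalLinear.smul_whiskerRight, Linear.comp_smul, mp_smul])
    (by intros; rw [map_add]) (by intros; rw [map_smul])
    (by
      intro y z y' z' f g u b
      rw [unitEl_mp, ← mp_comp, ← mp_comp]
      refine mp_congr _ ?_ _
      simp [MonoidalCategory.tensorHom_def, ← whisker_exchange, ← whisker_exchange_assoc])

@[simp] lemma leftUnitHom_pr (F : LinFun R X) {y z : X} (u : (dayUnit R X).El y) (b : F.El z) :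
    ev (leftUnitHom F) _ (pr u b) = F.mp ((λ_ z).inv ≫ unitEl y u ▷ z) b :=
  dayLift_pr _ _ _ _ _ _ _ _ _ _

/-- The inverse of the left unitor. -/
def leftUnitInv (F : LinFun R X) : F ⟶ day (dayUnit R X) F :=
  homMk (fun x => ((day (dayUnit R X) F).mp (λ_ x).hom).comp
      (prLin (dayUnit R X) F (𝟙_ X) x (unitOne R X)))
    (by
      intro x y f b
      change (day (dayUnit R X) F).mp (λ_ y).hom (pr (unitOne R X) (F.mp f b)) =
        (day (dayUnit R X) F).mp f ((day (dayUnit R X) F).mp (λ_ x).hom (pr (unitOne R X) b))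
      rw [pr_mp_right, ← mp_comp, ← mp_comp, leftUnitor_naturality])

lemma leftUnitInv_ev (F : LinFun R X) {x : X} (b : F.El x) :
    ev (leftUnitInv F) x b = (day (dayUnit R X) F).mp (λ_ x).hom (pr (unitOne R X) b) := rfl

/-- The right unitor `a ⊗ u ↦ F((y ⊗ u) ∘ ρ⁻¹)(a)`. -/
def rightUnitHom (F : LinFun R X) : day F (dayUnit R X) ⟶ F :=
  dayLift (fun y z a u => F.mp ((ρ_ y).inv ≫ y ◁ unitEl z u) a)
    (by intros; rw [map_add]) (by intros; rw [map_smul])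
    (by
      intro y z a u v
      rw [map_add, MonoidalPreadditive.whiskerLeft_add, Preadditive.comp_add, mp_add])
    (by
      intro y z r a u
      rw [map_smul, MonoidalLinear.whiskerLeft_smul, Linear.comp_smul, mp_smul])
    (by
      intro y z y' z' f g a u
      rw [unitEl_mp, ← mp_comp, ← mp_comp]
      refine mp_congr _ ?_ _
      simp [MonoidalCategory.tensorHom_def', whisker_exchange, whisker_exchange_assoc])

@[simp] lemma rightUnitHom_pr (F : LinFun R X) {y z : X} (a : F.El y) (u : (dayUnit R X).El z) :
    ev (rightUnitHom F) _ (pr a u) = F.mp ((ρ_ y).inv ≫ y ◁ unitEl z u) a :=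
  dayLift_pr _ _ _ _ _ _ _ _ _ _

/-- The inverse of the right unitor. -/
def rightUnitInv (F : LinFun R X) : F ⟶ day F (dayUnit R X) :=
  homMk (fun x => ((day F (dayUnit R X)).mp (ρ_ x).hom).comp
      ((prLin F (dayUnit R X) x (𝟙_ X)).flip (unitOne R X)))
    (by
      intro x y f b
      change (day F (dayUnit R X)).mp (ρ_ y).hom (pr (F.mp f b) (unitOne R X)) =
        (day F (dayUnit R X)).mp f ((day F (dayUnit R X)).mp (ρ_ x).hom (pr b (unitOne R X)))
      rw [pr_mp_left, ← mp_comp, ← mp_comp, rightUnitor_naturality])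

lemma rightUnitInv_ev (F : LinFun R X) {x : X} (b : F.El x) :
    ev (rightUnitInv F) x b = (day F (dayUnit R X)).mp (ρ_ x).hom (pr b (unitOne R X)) := rfl

instance : MonoidalCategoryStruct (LinFun R X) where
  tensorObj F G := day F G
  tensorHom η θ := dayHom η θ
  whiskerLeft F _ _ η := dayHom (𝟙 F) η
  whiskerRight η F := dayHom η (𝟙 F)
  tensorUnit := dayUnit R X
  associator F G H :=
    { hom := assocHom F G H
      inv := assocInv F G H
      hom_inv_id := day_hom_ext_left (by
        intro x y z a b c
        rw [ev_comp, assocHom_pr, ev_mp, assocInv_pr, ← mp_comp, Iso.hom_inv_id, mp_id, ev_id])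
      inv_hom_id := day_hom_ext_right (by
        intro x y z a b c
        rw [ev_comp, assocInv_pr, ev_mp, assocHom_pr, ← mp_comp, Iso.inv_hom_id, mp_id, ev_id]) }
  leftUnitor F :=
    { hom := leftUnitHom F
      inv := leftUnitInv F
      hom_inv_id := day_hom_ext (by
        intro y z u b
        rw [ev_comp, leftUnitHom_pr, ev_mp, leftUnitInv_ev, ← mp_comp, Iso.hom_inv_id_assoc,
          ← pr_mp_left, mp_unitOne, ev_id])
      inv_hom_id := hom_ext (by
        intro x b
        rw [ev_comp, leftUnitInv_ev, ev_mp, leftUnitHom_pr, ← mp_comp]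
        simp) }
  rightUnitor F :=
    { hom := rightUnitHom F
      inv := rightUnitInv F
      hom_inv_id := day_hom_ext (by
        intro y z a u
        rw [ev_comp, rightUnitHom_pr, ev_mp, rightUnitInv_ev, ← mp_comp, Iso.hom_inv_id_assoc,
          ← pr_mp_right, mp_unitOne, ev_id])
      inv_hom_id := hom_ext (by
        intro x b
        rw [ev_comp, rightUnitInv_ev, ev_mp, rightUnitHom_pr, ← mp_comp]
        simp) }

/-- The monoidal category `𝓕`. -/
instance : MonoidalCategory (LinFun R X) :=
  MonoidalCategory.ofTensorHom
    (id_tensorHom_id := fun F G => day_hom_ext (by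
      intro y z a b
      change ev (dayHom (𝟙 F) (𝟙 G)) _ _ = _
      rw [dayHom_pr, ev_id, ev_id]; rfl))
    (id_tensorHom := fun _ _ _ _ => rfl)
    (tensorHom_id := fun _ _ => rfl)
    (tensorHom_comp_tensorHom := fun f₁ f₂ g₁ g₂ => day_hom_ext (by
      intro y z a b
      change ev (dayHom g₁ g₂) _ (ev (dayHom f₁ f₂) _ _) = ev (dayHom (f₁ ≫ g₁) (f₂ ≫ g₂)) _ _
      rw [dayHom_pr, dayHom_pr, dayHom_pr, ev_comp, ev_comp]))
    (associator_naturality := fun {F₁ F₂ F₃ G₁ G₂ G₃} f₁ f₂ f₃ => day_hom_ext_left (by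
      intro x y z a b c
      change ev (assocHom G₁ G₂ G₃) _ (ev (dayHom (dayHom f₁ f₂) f₃) _ _) =
        ev (dayHom f₁ (dayHom f₂ f₃)) _ (ev (assocHom F₁ F₂ F₃) _ _)
      rw [dayHom_pr, dayHom_pr, assocHom_pr, assocHom_pr, ev_mp, dayHom_pr, dayHom_pr]))
    (leftUnitor_naturality := fun {F G} f => day_hom_ext (by
      intro y z u b
      change ev (leftUnitHom G) _ (ev (dayHom (𝟙 (dayUnit R X)) f) _ _) =
        ev f _ (ev (leftUnitHom F) _ _)
      rw [dayHom_pr, leftUnitHom_pr, leftUnitHom_pr, ev_mp, ev_id]))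
    (rightUnitor_naturality := fun {F G} f => day_hom_ext (by
      intro y z u b
      change ev (rightUnitHom G) _ (ev (dayHom f (𝟙 (dayUnit R X))) _ _) =
        ev f _ (ev (rightUnitHom F) _ _)
      rw [dayHom_pr, rightUnitHom_pr, rightUnitHom_pr, ev_mp, ev_id]))
    (pentagon := fun F G H K => day_hom_ext_left (by
      intro x y z t c d
      change ev (dayHom (𝟙 F) (assocHom G H K)) _ (ev (assocHom F (day G H) K) _
          (ev (dayHom (assocHom F G H) (𝟙 K)) _ (pr (pr t c) d))) =
        ev (assocHom F G (day H K)) _ (ev (assocHom (day F G) H K) _ (pr (pr t c) d))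
      induction t using day_induction with
      | zero => simp only [pr_zero_left, map_zero]
      | add s t hs ht => simp only [pr_add_left, map_add, hs, ht]
      | pure y₁ y₂ φ a b =>
        simp only [pr_mp_left, ev_mp]
        congr 1
        simp only [dayHom_pr, assocHom_pr, ev_id, pr_mp_left, ev_mp, pr_mp_right, ← mp_comp]
        congr 2
        simp))
    (triangle := fun F G => day_hom_ext_left (by
      intro x y z a u b
      change ev (dayHom (𝟙 F) (leftUnitHom G)) _ (ev (assocHom F (dayUnit R X) G) _ _) =
        ev (dayHom (rightUnitHom F) (𝟙 G)) _ _
      simp only [dayHom_pr, assocHom_pr, ev_id, leftUnitHom_pr, rightUnitHom_pr, pr_mp_left,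
        ev_mp, pr_mp_right, ← mp_comp]
      congr 2
      simp))

end Structure

/-! ### Monoids and modules in `𝓕` -/

section Modules

variable [MonoidalPreadditive X] [MonoidalLinear R X] {A : LinFun R X} [MonObj A]

/-- The product `a × b ∈ A(y ⊗ z)` of `a ∈ A(y)` and `b ∈ A(z)`. -/
def mulE {y z : X} (a : A.El y) (b : A.El z) : A.El (y ⊗ z) :=
  ev (MonObj.mul : A ⊗ A ⟶ A) (y ⊗ z) (pr a b)

variable (A) in
/-- The identity element in `A(𝟙)`. -/
def oneE : A.El (𝟙_ X) := ev (MonObj.one : 𝟙_ (LinFun R X) ⟶ A) (𝟙_ X) (unitOne R X)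

/-- The product `a × m ∈ M(y ⊗ z)` of `a ∈ A(y)` and `m ∈ M(z)`, for an `A`-module `M`. -/
def act {M : Mod (LinFun R X) A} {y z : X} (a : A.El y) (m : M.X.El z) : M.X.El (y ⊗ z) :=
  ev (F := day A M.X) (ModObj.smul (M := A) (X := M.X)) (y ⊗ z) (pr a m)

section

variable {M : Mod (LinFun R X) A} {x y z : X}

lemma act_add_left (a a' : A.El y) (m : M.X.El z) : act (a + a') m = act a m + act a' m := by
  rw [act, pr_add_left, map_add]; rfl

lemma act_smul_left (r : R) (a : A.El y) (m : M.X.El z) : act (r • a) m = r • act a m := by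
  rw [act, pr_smul_left, map_smul]; rfl

lemma act_add_right (a : A.El y) (m m' : M.X.El z) : act a (m + m') = act a m + act a m' := by
  rw [act, pr_add_right, map_add]; rfl

lemma act_smul_right (r : R) (a : A.El y) (m : M.X.El z) : act a (r • m) = r • act a m := by
  rw [act, pr_smul_right, map_smul]; rfl

lemma act_mp {y' z' : X} (f : y ⟶ y') (g : z ⟶ z') (a : A.El y) (m : M.X.El z) :
    act (A.mp f a) (M.X.mp g m) = M.X.mp (f ⊗ₘ g) (act a m) := by
  rw [act, pr_mp, ev_mp]; rfl

lemma act_mp_right {z' : X} (g : z ⟶ z') (a : A.El y) (m : M.X.El z) :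
    act a (M.X.mp g m) = M.X.mp (y ◁ g) (act a m) := by
  rw [act, pr_mp_right, ev_mp]; rfl

lemma act_mp_left {y' : X} (f : y ⟶ y') (a : A.El y) (m : M.X.El z) :
    act (A.mp f a) m = M.X.mp (f ▷ z) (act a m) := by
  rw [act, pr_mp_left, ev_mp]; rfl

lemma one_act (m : M.X.El z) : act (oneE A) m = M.X.mp (λ_ z).inv m := by
  have h := congrArg (fun η : day (dayUnit R X) M.X ⟶ M.X => ev η _ (pr (unitOne R X) m))
    (ModObj.one_smul (M := A) M.X)
  change ev (F := day A M.X) (ModObj.smul (M := A) (X := M.X)) _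
    (ev (dayHom (MonObj.one : 𝟙_ (LinFun R X) ⟶ A) (𝟙 M.X)) _ (pr (unitOne R X) m)) =
      ev (leftUnitHom M.X) _ (pr (unitOne R X) m) at h
  rw [dayHom_pr, leftUnitHom_pr, unitEl_unitOne, id_whiskerRight, Category.comp_id, ev_id] at h
  exact h

lemma mul_act (a : A.El x) (b : A.El y) (m : M.X.El z) :
    act (mulE a b) m = M.X.mp (α_ x y z).inv (act a (act b m)) := by
  have h := congrArg (fun η : day (day A A) M.X ⟶ M.X => ev η _ (pr (pr a b) m))
    (ModObj.mul_smul (M := A) M.X)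
  let σ : day A M.X ⟶ M.X := ModObj.smul (M := A) (X := M.X)
  let μ : day A A ⟶ A := MonObj.mul
  change ev σ _ (ev (dayHom μ (𝟙 M.X)) _ (pr (pr a b) m)) =
      ev σ _ (ev (dayHom (𝟙 A) σ) _ (ev (assocHom A A M.X) _ (pr (pr a b) m))) at h
  rw [assocHom_pr, ev_mp, ev_mp, dayHom_pr, dayHom_pr, ev_id, ev_id] at h
  exact h

/-- `m ↦ a × m` as a linear map. -/
def actLin {M : Mod (LinFun R X) A} {y : X} (a : A.El y) (z : X) :
    M.X.El z →ₗ[R] M.X.El (y ⊗ z) where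
  toFun m := act a m
  map_add' := act_add_right a
  map_smul' r m := act_smul_right r a m

@[simp] lemma actLin_apply (a : A.El y) (m : M.X.El z) : actLin a z m = act a m := rfl

end

/-- Build an `A`-module from a natural bilinear pairing that is unital and associative. -/
def modOfAct (M : LinFun R X) (p : ∀ (y z : X), A.El y → M.El z → M.El (y ⊗ z))
    (left_add : ∀ y z a a' b, p y z (a + a') b = p y z a b + p y z a' b)
    (left_smul : ∀ y z (r : R) a b, p y z (r • a) b = r • p y z a b)
    (right_add : ∀ y z a b b', p y z a (b + b') = p y z a b + p y z a b')
    (right_smul : ∀ y z (r : R) a b, p y z a (r • b) = r • p y z a b)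
    (nat : ∀ y z y' z' (f : y ⟶ y') (g : z ⟶ z') a b,
      p y' z' (A.mp f a) (M.mp g b) = M.mp (f ⊗ₘ g) (p y z a b))
    (one : ∀ z m, p (𝟙_ X) z (oneE A) m = M.mp (λ_ z).inv m)
    (mul : ∀ x y z a b m, p (x ⊗ y) z (mulE a b) m =
      M.mp (α_ x y z).inv (p x (y ⊗ z) a (p y z b m))) :
    Mod (LinFun R X) A where
  X := M
  mod :=
    { smul := dayLift p left_add left_smul right_add right_smul nat
      one_smul := day_hom_ext (F := dayUnit R X) (G := M) (by
        intro y z u m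
        change ev (dayLift p left_add left_smul right_add right_smul nat) _
          (ev (dayHom (MonObj.one : 𝟙_ (LinFun R X) ⟶ A) (𝟙 M)) _ (pr u m)) =
            ev (leftUnitHom M) _ (pr u m)
        rw [dayHom_pr, leftUnitHom_pr, dayLift_pr, ev_id]
        have hu : ev (MonObj.one : 𝟙_ (LinFun R X) ⟶ A) y u = A.mp (unitEl y u) (oneE A) := by
          rw [oneE, ← ev_mp]
          exact congrArg _ (mp_unitOne u).symm
        have h := nat _ _ _ _ (unitEl y u) (𝟙 z) (oneE A) m
        rw [mp_id, one, ← mp_comp, tensorHom_id] at h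
        rw [← h]
        exact congrArg (fun c => p y z c m) hu)
      mul_smul := day_hom_ext_left (F := A) (G := A) (H := M) (by
        intro x y z a b m
        change ev (dayLift p left_add left_smul right_add right_smul nat) _
          (ev (dayHom (MonObj.mul : A ⊗ A ⟶ A) (𝟙 M)) _ (pr (pr a b) m)) =
            ev (dayLift p left_add left_smul right_add right_smul nat) _
              (ev (dayHom (𝟙 A) (dayLift p left_add left_smul right_add right_smul nat)) _
                (ev (assocHom A A M) _ (pr (pr a b) m)))
        rw [assocHom_pr, ev_mp, ev_mp, dayHom_pr, dayHom_pr, dayLift_pr, dayLift_pr, dayLift_pr,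
          ev_id, ev_id]
        exact mul x y z a b m) }

/-- Build a morphism of `A`-modules from its components. -/
def modHomMk {M N : Mod (LinFun R X) A} (η : ∀ x, M.X.El x →ₗ[R] N.X.El x)
    (nat : ∀ x y (f : x ⟶ y) (m : M.X.El x), η y (M.X.mp f m) = N.X.mp f (η x m))
    (hact : ∀ y z (a : A.El y) (m : M.X.El z), η (y ⊗ z) (act a m) = act a (η z m)) : M ⟶ N :=
  Mod.Hom.mk' (homMk η (fun f m => nat _ _ f m)) (day_hom_ext (F := A) (G := M.X) (by
    intro y z a m
    change η (y ⊗ z) (act a m) =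
      ev (F := day A N.X) (ModObj.smul (M := A) (X := N.X)) _
        (ev (dayHom (𝟙 A) (homMk η (fun f m => nat _ _ f m))) _ (pr a m))
    rw [dayHom_pr, hact]
    rfl))

/-- The component at `x` of a morphism of `A`-modules. -/
def mev {M N : Mod (LinFun R X) A} (f : M ⟶ N) (x : X) : M.X.El x →ₗ[R] N.X.El x := ev f.hom x

/-- Exactness at `N` of `M ⟶ N ⟶ P`. Kernels and images of morphisms of `A`-modules are computed
pointwise in `R`-modules. -/
def ModExact {M N P : Mod (LinFun R X) A} (f : M ⟶ N) (g : N ⟶ P) : Prop :=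
  ∀ x : X, Function.Exact (mev f x) (mev g x)

/-- `A`-submodules of an `A`-module `M`: subfunctors stable under the action of `A`. -/
structure SubMod (M : Mod (LinFun R X) A) where
  carrier : ∀ x : X, Submodule R (M.X.El x)
  mp_mem : ∀ {x y : X} (f : x ⟶ y) {m : M.X.El x}, m ∈ carrier x → M.X.mp f m ∈ carrier y
  act_mem : ∀ {y z : X} (a : A.El y) {m : M.X.El z}, m ∈ carrier z → act a m ∈ carrier (y ⊗ z)

/-- The submodule generated by a set of elements of `M(v)`: the intersection of all submodules
that contain it. -/
def SubMod.generated (M : Mod (LinFun R X) A) {v : X} (S : Set (M.X.El v)) : SubMod M where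
  carrier x := ⨅ N : {N : SubMod M // S ⊆ N.carrier v}, N.1.carrier x
  mp_mem f m hm := by
    rw [Submodule.mem_iInf] at hm ⊢
    exact fun N => N.1.mp_mem f (hm N)
  act_mem a m hm := by
    rw [Submodule.mem_iInf] at hm ⊢
    exact fun N => N.1.act_mem a (hm N)

/-- The functor underlying the quotient module. -/
def SubMod.quotFun {M : Mod (LinFun R X) A} (N : SubMod M) : LinFun R X :=
  ofData (fun x => M.X.El x ⧸ N.carrier x)
    (fun {x y} f => Submodule.mapQ (N.carrier x) (N.carrier y) (M.X.mp f)
      (fun _ hm => N.mp_mem f hm))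
    (fun x a => by
      obtain ⟨a, rfl⟩ := Submodule.Quotient.mk_surjective _ a
      simp)
    (fun f g a => by
      obtain ⟨a, rfl⟩ := Submodule.Quotient.mk_surjective _ a
      simp [mp_comp])
    (fun f g a => by
      obtain ⟨a, rfl⟩ := Submodule.Quotient.mk_surjective _ a
      simp [mp_add])
    (fun r f a => by
      obtain ⟨a, rfl⟩ := Submodule.Quotient.mk_surjective _ a
      simp [mp_smul])

/-- The class in `(M / N)(x)` of an element of `M(x)`. -/
def SubMod.mkQ {M : Mod (LinFun R X) A} (N : SubMod M) (x : X) :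
    M.X.El x →ₗ[R] N.quotFun.El x := (N.carrier x).mkQ

lemma SubMod.mkQ_surjective {M : Mod (LinFun R X) A} (N : SubMod M) (x : X) :
    Function.Surjective (N.mkQ x) := Submodule.mkQ_surjective (N.carrier x)

lemma SubMod.mp_mkQ {M : Mod (LinFun R X) A} (N : SubMod M) {x y : X} (f : x ⟶ y)
    (m : M.X.El x) : N.quotFun.mp f (N.mkQ x m) = N.mkQ y (M.X.mp f m) := rfl

/-- The action of `a ∈ A(y)` on the quotient module. -/
def SubMod.quotAct {M : Mod (LinFun R X) A} (N : SubMod M) {y : X} (a : A.El y) (z : X) :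
    N.quotFun.El z →ₗ[R] N.quotFun.El (y ⊗ z) :=
  Submodule.mapQ (N.carrier z) (N.carrier (y ⊗ z)) (actLin a z) (fun _ hm => N.act_mem a hm)

lemma SubMod.quotAct_mkQ {M : Mod (LinFun R X) A} (N : SubMod M) {y z : X} (a : A.El y)
    (m : M.X.El z) : N.quotAct a z (N.mkQ z m) = N.mkQ (y ⊗ z) (act a m) := rfl

/-- The quotient module `M / N`. -/
def SubMod.quot {M : Mod (LinFun R X) A} (N : SubMod M) : Mod (LinFun R X) A :=
  modOfAct N.quotFun (fun y z a b => N.quotAct a z b)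
    (by
      intro y z a a' b
      obtain ⟨b, rfl⟩ := N.mkQ_surjective _ b
      simp only [quotAct_mkQ, act_add_left, map_add])
    (by
      intro y z r a b
      obtain ⟨b, rfl⟩ := N.mkQ_surjective _ b
      simp only [quotAct_mkQ, act_smul_left, map_smul])
    (by intros; rw [map_add]) (by intros; rw [map_smul])
    (by
      intro y z y' z' f g a b
      obtain ⟨b, rfl⟩ := N.mkQ_surjective _ b
      simp only [quotAct_mkQ, mp_mkQ, act_mp])
    (by
      intro z b
      obtain ⟨b, rfl⟩ := N.mkQ_surjective _ b
      simp only [quotAct_mkQ, mp_mkQ, one_act])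
    (by
      intro x y z a a' b
      obtain ⟨b, rfl⟩ := N.mkQ_surjective _ b
      simp only [quotAct_mkQ, mp_mkQ, mul_act])

/-- The projection `M ⟶ M / N`. -/
def SubMod.proj {M : Mod (LinFun R X) A} (N : SubMod M) : M ⟶ N.quot :=
  modHomMk (N := N.quot) N.mkQ (fun _ _ f m => (N.mp_mkQ f m).symm)
    (fun y z a m => by
      have h : act (M := N.quot) a (N.mkQ z m) = N.quotAct a z (N.mkQ z m) :=
        dayLift_pr _ _ _ _ _ _ _ _ _ _
      exact h.symm)

/-- The functor `⨁_{i ∈ I} F`, for a finite set `I`. -/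
def powFun (I : Type) [Finite I] (F : LinFun R X) : LinFun R X :=
  ofData (fun x => I → F.El x) (fun f => (F.mp f).compLeft I)
    (fun x a => by ext i; simp)
    (fun f g a => by ext i; simp [mp_comp])
    (fun f g a => by ext i; simp [mp_add])
    (fun r f a => by ext i; simp [mp_smul])

/-- The module `⨁_{i ∈ I} M`, for a finite set `I`. -/
def powMod (I : Type) [Finite I] (M : Mod (LinFun R X) A) : Mod (LinFun R X) A :=
  modOfAct (powFun I M.X) (fun _ z a (b : I → M.X.El z) => fun i => act a (b i))
    (fun _ _ a a' _ => funext fun _ => act_add_left a a' _)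
    (fun _ _ r a _ => funext fun _ => act_smul_left r a _)
    (fun _ _ a _ _ => funext fun _ => act_add_right a _ _)
    (fun _ _ r a _ => funext fun _ => act_smul_right r a _)
    (fun _ _ _ _ f g a _ => funext fun _ => act_mp f g a _)
    (fun _ _ => funext fun _ => one_act _)
    (fun _ _ _ a a' _ => funext fun _ => mul_act a a' _)

lemma powMod_mp {I : Type} [Finite I] {M : Mod (LinFun R X) A} {x y : X} (f : x ⟶ y)
    (b : I → M.X.El x) : (powMod I M).X.mp f b = fun i => M.X.mp f (b i) := rfl

lemma powMod_act {I : Type} [Finite I] {M : Mod (LinFun R X) A} {y z : X} (a : A.El y)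
    (b : I → M.X.El z) : act (M := powMod I M) a b = fun i => act a (b i) :=
  dayLift_pr (F := A) (G := powFun I M.X) (H := powFun I M.X) _ _ _ _ _ _ _ _ _ _

/-- The projection onto the summand `i`. -/
def powProj {I : Type} [Finite I] (M : Mod (LinFun R X) A) (i : I) : powMod I M ⟶ M :=
  modHomMk (M := powMod I M)
    (fun x => LinearMap.proj (R := R) (φ := fun _ : I => M.X.El x) i) (fun _ _ _ _ => rfl)
    (fun _ _ a b => congrFun (powMod_act (M := M) a b) i)

/-- The inclusion of the summand `i`. -/
def powIncl {I : Type} [Finite I] [DecidableEq I] (M : Mod (LinFun R X) A) (i : I) : M ⟶ powMod I M :=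
  modHomMk (N := powMod I M)
    (fun x => LinearMap.single R (fun _ : I => M.X.El x) i)
    (fun x y f m => by
      funext j
      change Pi.single (M := fun _ : I => M.X.El y) i (M.X.mp f m) j =
        M.X.mp f (Pi.single (M := fun _ : I => M.X.El x) i m j)
      by_cases h : j = i
      · subst h; simp
      · simp [h])
    (fun y z a m => by
      refine Eq.trans ?_ (powMod_act (M := M) a _).symm
      funext j
      change Pi.single (M := fun _ : I => M.X.El (y ⊗ z)) i (actLin a z m) j =
        actLin a z (Pi.single (M := fun _ : I => M.X.El z) i m j)
      by_cases h : j = i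
      · subst h; simp
      · rw [Pi.single_eq_of_ne h, Pi.single_eq_of_ne h, map_zero])

lemma powProj_apply {I : Type} [Finite I] (M : Mod (LinFun R X) A) (i : I) {x : X}
    (b : I → M.X.El x) : mev (powProj M i) x b = b i := rfl

lemma powIncl_apply {I : Type} [Finite I] [DecidableEq I] (M : Mod (LinFun R X) A) (i : I)
    {x : X} (m : M.X.El x) :
    mev (powIncl M i) x m = (Pi.single i m : I → M.X.El x) := rfl

lemma mev_mp {M N : Mod (LinFun R X) A} (f : M ⟶ N) {x y : X} (g : x ⟶ y) (m : M.X.El x) :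
    mev f y (M.X.mp g m) = N.X.mp g (mev f x m) := ev_mp f.hom g m

lemma mev_act {M N : Mod (LinFun R X) A} (f : M ⟶ N) {y z : X} (a : A.El y) (m : M.X.El z) :
    mev f (y ⊗ z) (act a m) = act a (mev f z m) := by
  let σ : day A M.X ⟶ M.X := ModObj.smul (M := A) (X := M.X)
  let τ : day A N.X ⟶ N.X := ModObj.smul (M := A) (X := N.X)
  have h := congrArg (fun k : day A M.X ⟶ N.X => ev k _ (pr a m))
    (IsModHom.smul_hom (A := A) (f := f.hom))
  change ev f.hom _ (ev σ _ (pr a m)) = ev τ _ (ev (dayHom (𝟙 A) f.hom) _ (pr a m)) at h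
  rw [dayHom_pr, ev_id] at h
  exact h

variable (A) in
/-- `A` as a module over itself. -/
abbrev regMod : Mod (LinFun R X) A where
  X := A
  mod := ModObj.regular A

lemma regMod_act {y z : X} (a : A.El y) (b : A.El z) : act (M := regMod A) a b = mulE a b := rfl

end Modules

/-! ### The Koszul complex -/

section Koszul

variable [MonoidalPreadditive X] [MonoidalLinear R X] [SymmetricCategory X]

/-- The commutant `CA(x)`: the `b ∈ A(x)` with `a × b = A(s)(b × a)` for all `y` and `a ∈ A(y)`,
where `s : x ⊗ y ⟶ y ⊗ x` is the symmetry. -/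
def commutant (A : LinFun R X) [MonObj A] (x : X) : Submodule R (A.El x) where
  carrier := {b | ∀ (y : X) (a : A.El y), mulE a b = A.mp (β_ x y).hom (mulE b a)}
  add_mem' {b c} hb hc y a := by
    rw [← regMod_act, ← regMod_act, act_add_right, act_add_left, map_add]
    exact congrArg₂ _ (hb y a) (hc y a)
  zero_mem' y a := by
    rw [← regMod_act, ← regMod_act, ← zero_smul R (0 : A.El x), act_smul_right, act_smul_left]
    simp
  smul_mem' r b hb y a := by
    rw [← regMod_act, ← regMod_act, act_smul_right, act_smul_left, map_smul]
    exact congrArg _ (hb y a)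

variable {A : LinFun R X} [MonObj A]

/-- Multiplication `L_a : A ⟶ A` by `a ∈ CA(𝟙)`, given by `b ↦ A(λ_x)(a × b)`. -/
def mulLeft (a : commutant A (𝟙_ X)) : regMod A ⟶ regMod A :=
  modHomMk (fun x => (A.mp (λ_ x).hom).comp (actLin (M := regMod A) a.1 x))
    (by
      intro x y f b
      change A.mp (λ_ y).hom (act (M := regMod A) a.1 (A.mp f b)) =
        A.mp f (A.mp (λ_ x).hom (act (M := regMod A) a.1 b))
      rw [act_mp_right, ← mp_comp, ← mp_comp, leftUnitor_naturality])
    (by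
      intro y z c b
      change A.mp (λ_ (y ⊗ z)).hom (act (M := regMod A) a.1 (act (M := regMod A) c b)) =
        act (M := regMod A) c (A.mp (λ_ z).hom (act (M := regMod A) a.1 b))
      have h₁ := mul_act (M := regMod A) a.1 c b
      have h₂ := mul_act (M := regMod A) c a.1 b
      rw [a.2 y c, act_mp_left, h₁] at h₂
      have h₃ := congrArg ((regMod A).X.mp (α_ y (𝟙_ X) z).hom) h₂
      rw [← mp_comp, ← mp_comp, ← mp_comp, Iso.inv_hom_id, mp_id] at h₃
      rw [act_mp_right, ← h₃, ← mp_comp]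
      refine mp_congr _ ?_ _
      simp [← comp_whiskerRight])

/-- The subsets of `{1, …, n}` with `p` elements. -/
abbrev KIdx (n p : ℕ) : Type := {S : Finset (Fin n) // S.card = p}

/-- The subset `S ∖ {i}` for `i ∈ S`. -/
def KIdx.erase {n p : ℕ} (S : KIdx n (p + 1)) (i : S.1) : KIdx n p :=
  ⟨S.1.erase i, by rw [Finset.card_erase_of_mem i.2, S.2, Nat.add_sub_cancel]⟩

/-- The position of `i` in `S = {i_1 < … < i_p}`, counted from `0`. -/
def KIdx.pos {n p : ℕ} (S : KIdx n p) (i : S.1) : ℕ := (S.1.filter (fun j => j < i.1)).card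

variable (A) in
/-- The module `K_p^n(A)`, the direct sum of copies of `A` over the `p`-subsets of `{1, …, n}`. -/
abbrev koszul (n p : ℕ) : Mod (LinFun R X) A := powMod (KIdx n p) (regMod A)

/-- The component at `x` of the Koszul differential. On the summand `A_S`, for
`S = {i_1 < … < i_{p+1}}`, it is the sum over `k` of `(-1)^(k+1)` times multiplication by
`α_{i_k}` into the summand of `S ∖ {i_k}`. -/
def koszulDEl {n : ℕ} (α : Fin n → commutant A (𝟙_ X)) (p : ℕ) (x : X) :
    (koszul A n (p + 1)).X.El x →ₗ[R] (koszul A n p).X.El x :=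
  ∑ S : KIdx n (p + 1), ∑ i : S.1, (-1 : R) ^ S.pos i •
    mev (powProj (regMod A) S ≫ mulLeft (α i) ≫ powIncl (regMod A) (S.erase i)) x

/-- The Koszul differential `d : K_{p+1}^n(A) ⟶ K_p^n(A)`. -/
def koszulD {n : ℕ} (α : Fin n → commutant A (𝟙_ X)) (p : ℕ) :
    koszul A n (p + 1) ⟶ koszul A n p :=
  modHomMk (koszulDEl α p)
    (fun x y f b => by
      simp only [koszulDEl, LinearMap.sum_apply, LinearMap.smul_apply, map_sum, map_smul, mev_mp])
    (fun y z a b => by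
      rw [← actLin_apply a (koszulDEl α p z b)]
      simp only [koszulDEl, LinearMap.sum_apply, LinearMap.smul_apply, map_sum, map_smul,
        mev_act, actLin_apply])

variable (A) in
/-- The identification `K_0^n(A) = A`. -/
def koszulZero (n : ℕ) : koszul A n 0 ≅ regMod A where
  hom := powProj (regMod A) ⟨∅, Finset.card_empty⟩
  inv := powIncl (regMod A) ⟨∅, Finset.card_empty⟩
  hom_inv_id := by
    apply Mod.Hom.ext
    apply hom_ext
    intro x b
    funext S
    obtain ⟨S, hS⟩ := S
    obtain rfl := Finset.card_eq_zero.1 hS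
    exact Pi.single_eq_same (M := fun _ : KIdx n 0 => A.El x) (⟨∅, Finset.card_empty⟩ : KIdx n 0)
      (b ⟨∅, Finset.card_empty⟩ : A.El x)
  inv_hom_id := by
    apply Mod.Hom.ext
    apply hom_ext
    intro x b
    exact Pi.single_eq_same (M := fun _ : KIdx n 0 => A.El x) (⟨∅, Finset.card_empty⟩ : KIdx n 0)
      (b : A.El x)

/-- The morphism `L_α : A^n ⟶ A`, the last differential of the Koszul complex. -/
def koszulL {n : ℕ} (α : Fin n → commutant A (𝟙_ X)) : koszul A n 1 ⟶ regMod A :=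
  koszulD α 0 ≫ (koszulZero A n).hom

/-- The submodule `A⟨α_i, i ∈ I⟩` of `A` generated by the `α_i` with `i ∈ I`. -/
def spanSub {n : ℕ} (α : Fin n → commutant A (𝟙_ X)) (I : Set (Fin n)) : SubMod (regMod A) :=
  SubMod.generated (regMod A) (v := 𝟙_ X) ((fun i => (α i : A.El (𝟙_ X))) '' I)

/-- `a` is `M`-regular. -/
def IsRegularOn (M : Mod (LinFun R X) A) (a : commutant A (𝟙_ X)) : Prop :=
  ∀ (x : X) (m : M.X.El x), m ≠ 0 → act a.1 m ≠ 0

/-- Regular sequences: `α_i` is regular on `A / A⟨α_1, …, α_{i-1}⟩` for all `i`, and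
`A / A⟨α_1, …, α_n⟩` is not zero. -/
structure IsRegularSeq {n : ℕ} (α : Fin n → commutant A (𝟙_ X)) : Prop where
  regular : ∀ i : Fin n, IsRegularOn (spanSub α {j | j < i}).quot (α i)
  nonzero : ∃ x : X, Nontrivial ((spanSub α Set.univ).quot.X.El x)

end Koszul


end Day

end LinFun

end

/-!
On each object `x`, the Koszul complex of `α` is the Koszul complex of the commuting endomorphisms
`ℓ_i = L_{α_i}` of the `R`-module `A(x)`, and `A⟨α_1, …, α_i⟩(x) = ∑_{j ≤ i} ℓ_j A(x)`, because the
`α_j` lie in the commutant.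

For commuting endomorphisms `ℓ_i` of a module `V`, the differential is `∑_i ℓ_i c_i` on
`Λ(Rⁿ) ⊗ V`, where `c_i` is the contraction with the `i`-th dual basis vector. Let `e_a` be the
exterior multiplication by the basis vector of a new index `a`; it satisfies
`c_a e_a + e_a c_a = 1` and anticommutes with the differential of the old indices. Splitting a cycle
`f` as `c_a e_a f + e_a c_a f` shows the enlarged complex to be the mapping cone of `ℓ_a` on the old
one. Hence it is exact in positive degrees if the old one is, provided that the class of
`c_a f` in degree zero, which `ℓ_a` kills, vanishes in `V / ∑_i ℓ_i V`: this is regularity.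
-/

namespace KoszulEnd

variable {R : Type*} [CommRing R] {V : Type*} [AddCommGroup V] [Module R V] {ι : Type*}

/-- The submodule `∑_{i ∈ I} ℓ_i(V)` of `V`. -/
def sumRange (ℓ : ι → Module.End R V) (I : Set ι) : Submodule R V :=
  ⨆ i ∈ I, LinearMap.range (ℓ i)

lemma apply_mem_sumRange (ℓ : ι → Module.End R V) {I : Set ι} {i : ι} (hi : i ∈ I) (v : V) :
    ℓ i v ∈ sumRange ℓ I :=
  Submodule.mem_iSup_of_mem i (Submodule.mem_iSup_of_mem hi ⟨v, rfl⟩)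

lemma map_mem_sumRange {W : Type*} [AddCommGroup W] [Module R W] {ℓ : ι → Module.End R V}
    {ℓ' : ι → Module.End R W} (φ : V →ₗ[R] W) (hφ : ∀ i v, φ (ℓ i v) = ℓ' i (φ v)) {I : Set ι}
    {v : V} (hv : v ∈ sumRange ℓ I) : φ v ∈ sumRange ℓ' I := by
  suffices h : sumRange ℓ I ≤ (sumRange ℓ' I).comap φ from h hv
  refine iSup₂_le fun i hi => ?_
  rintro _ ⟨u, rfl⟩
  rw [Submodule.mem_comap, hφ]
  exact apply_mem_sumRange ℓ' hi (φ u)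

lemma sumRange_insert (ℓ : ι → Module.End R V) (a : ι) (I : Set ι) :
    sumRange ℓ (insert a I) = LinearMap.range (ℓ a) ⊔ sumRange ℓ I := iSup_insert

variable (R V) in
/-- The submodule `Λ(R^s) ⊗ V` of `Λ(R^ι) ⊗ V`, whose elements are encoded as `V`-valued functions
of finite sets of indices: the value at `T` is the coefficient of the basis vector of `T`. -/
def supportedOn (s : Finset ι) : Submodule R (Finset ι → V) :=
  Submodule.pi {T | ¬T ⊆ s} fun _ => ⊥

lemma mem_supportedOn {s : Finset ι} {f : Finset ι → V} :
    f ∈ supportedOn R V s ↔ ∀ T, ¬T ⊆ s → f T = 0 := by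
  simp [supportedOn, Submodule.mem_pi]

lemma supportedOn_mono {s t : Finset ι} (hst : s ⊆ t) : supportedOn R V s ≤ supportedOn R V t :=
  fun _ hf => mem_supportedOn.2 fun T hT => mem_supportedOn.1 hf T fun hTs => hT (hTs.trans hst)

lemma compLeft_mem_supportedOn (φ : Module.End R V) {s : Finset ι} {f : Finset ι → V}
    (hf : f ∈ supportedOn R V s) : φ.compLeft (Finset ι) f ∈ supportedOn R V s :=
  mem_supportedOn.2 fun T hT => by simp [mem_supportedOn.1 hf T hT]

/-! ### Contraction and exterior multiplication -/

variable [LinearOrder ι]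

variable (R) in
/-- The Koszul sign `(-1)^k`, where `k` is the position of `i` in `T ∪ {i}` counted from `0`. -/
def sign (i : ι) (T : Finset ι) : R := (-1) ^ {j ∈ T | j < i}.card

lemma sign_mul_self (i : ι) (T : Finset ι) : sign R i T * sign R i T = 1 := by
  rw [sign, ← mul_pow, neg_one_mul, neg_neg, one_pow]

lemma sign_insert_self (i : ι) (T : Finset ι) : sign R i (insert i T) = sign R i T := by
  rw [sign, sign, Finset.filter_insert, if_neg (lt_irrefl i)]

lemma sign_insert_of_lt {i j : ι} (hij : i < j) (T : Finset ι) :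
    sign R i (insert j T) = sign R i T := by
  rw [sign, sign, Finset.filter_insert, if_neg hij.not_gt]

lemma sign_insert_of_gt {i j : ι} (hij : j < i) {T : Finset ι} (hj : j ∉ T) :
    sign R i (insert j T) = -sign R i T := by
  rw [sign, sign, Finset.filter_insert, if_pos hij,
    Finset.card_insert_of_notMem fun h => hj (Finset.mem_filter.1 h).1, pow_succ, mul_neg_one]

lemma sign_mul_sign_insert {i j : ι} (hij : i ≠ j) {T : Finset ι} (hi : i ∉ T) (hj : j ∉ T) :
    sign R i T * sign R j (insert i T) = -(sign R j T * sign R i (insert j T)) := by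
  rcases hij.lt_or_gt with h | h
  · rw [sign_insert_of_gt h hi, sign_insert_of_lt h]; ring
  · rw [sign_insert_of_gt h hj, sign_insert_of_lt h]; ring

lemma sign_insert_mul_sign_insert {i j : ι} (hij : i ≠ j) {T : Finset ι} (hi : i ∉ T)
    (hj : j ∉ T) : sign R i (insert j T) * sign R j (insert i T) = -(sign R j T * sign R i T) := by
  rcases hij.lt_or_gt with h | h
  · rw [sign_insert_of_gt h hi, sign_insert_of_lt h]; ring
  · rw [sign_insert_of_gt h hj, sign_insert_of_lt h]; ring

variable (R V) in
/-- Contraction with the `i`-th dual basis vector on `Λ(R^ι) ⊗ V`, encoded as in `supportedOn`. -/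
def contract (i : ι) : Module.End R (Finset ι → V) :=
  LinearMap.pi fun T => if i ∈ T then 0 else sign R i T • LinearMap.proj (insert i T)

variable (R V) in
/-- Left exterior multiplication by the `i`-th basis vector on `Λ(R^ι) ⊗ V`, encoded as in
`supportedOn`. -/
def wedge (i : ι) : Module.End R (Finset ι → V) :=
  LinearMap.pi fun T => if i ∈ T then sign R i T • LinearMap.proj (T.erase i) else 0

lemma contract_apply_of_mem {i : ι} {T : Finset ι} (hi : i ∈ T) (f : Finset ι → V) :
    contract R V i f T = 0 := by
  simp [contract, hi]

lemma contract_apply_of_notMem {i : ι} {T : Finset ι} (hi : i ∉ T) (f : Finset ι → V) :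
    contract R V i f T = sign R i T • f (insert i T) := by
  simp [contract, hi]

lemma wedge_apply_of_notMem {i : ι} {T : Finset ι} (hi : i ∉ T) (f : Finset ι → V) :
    wedge R V i f T = 0 := by
  simp [wedge, hi]

lemma wedge_apply_insert {i : ι} {T : Finset ι} (hi : i ∉ T) (f : Finset ι → V) :
    wedge R V i f (insert i T) = sign R i T • f T := by
  simp [wedge, sign_insert_self, Finset.erase_insert hi]

lemma contract_contract_self (i : ι) (f : Finset ι → V) :
    contract R V i (contract R V i f) = 0 := by
  funext T
  by_cases hi : i ∈ T
  · rw [contract_apply_of_mem hi, Pi.zero_apply]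
  · rw [contract_apply_of_notMem hi, contract_apply_of_mem (Finset.mem_insert_self i T),
      smul_zero, Pi.zero_apply]

lemma contract_contract (i j : ι) (f : Finset ι → V) :
    contract R V i (contract R V j f) = -contract R V j (contract R V i f) := by
  obtain rfl | hij := eq_or_ne i j
  · rw [contract_contract_self, neg_zero]
  funext T
  rw [Pi.neg_apply]
  by_cases hi : i ∈ T <;> by_cases hj : j ∈ T
  · rw [contract_apply_of_mem hi, contract_apply_of_mem hj, neg_zero]
  · rw [contract_apply_of_mem hi, contract_apply_of_notMem hj,
      contract_apply_of_mem (Finset.mem_insert_of_mem hi), smul_zero, neg_zero]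
  · rw [contract_apply_of_mem hj, contract_apply_of_notMem hi,
      contract_apply_of_mem (Finset.mem_insert_of_mem hj), smul_zero, neg_zero]
  · rw [contract_apply_of_notMem hi, contract_apply_of_notMem hj,
      contract_apply_of_notMem (by simp [hij.symm, hj]),
      contract_apply_of_notMem (by simp [hij, hi]), smul_smul, smul_smul,
      sign_mul_sign_insert hij hi hj, neg_smul, Finset.insert_comm]

lemma contract_wedge_apply_of_notMem {i : ι} {T : Finset ι} (hi : i ∉ T) (f : Finset ι → V) :
    contract R V i (wedge R V i f) T = f T := by
  rw [contract_apply_of_notMem hi, wedge_apply_insert hi, smul_smul, sign_mul_self, one_smul]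

lemma contract_wedge_add_wedge_contract (i : ι) (f : Finset ι → V) :
    contract R V i (wedge R V i f) + wedge R V i (contract R V i f) = f := by
  funext T
  rw [Pi.add_apply]
  by_cases hi : i ∈ T
  · obtain ⟨U, hiU, rfl⟩ : ∃ U, i ∉ U ∧ insert i U = T :=
      ⟨T.erase i, Finset.notMem_erase i T, Finset.insert_erase hi⟩
    rw [contract_apply_of_mem hi, wedge_apply_insert hiU, contract_apply_of_notMem hiU, smul_smul,
      sign_mul_self, one_smul, zero_add]
  · rw [contract_wedge_apply_of_notMem hi, wedge_apply_of_notMem hi, add_zero]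

lemma contract_wedge_of_contract_eq_zero {i : ι} {f : Finset ι → V} (hf : contract R V i f = 0) :
    contract R V i (wedge R V i f) = f := by
  simpa [hf] using contract_wedge_add_wedge_contract (R := R) i f

lemma contract_wedge_of_ne {i j : ι} (hij : i ≠ j) (f : Finset ι → V) :
    contract R V i (wedge R V j f) = -wedge R V j (contract R V i f) := by
  funext T
  rw [Pi.neg_apply]
  by_cases hj : j ∈ T
  · obtain ⟨U, hjU, rfl⟩ : ∃ U, j ∉ U ∧ insert j U = T :=
      ⟨T.erase j, Finset.notMem_erase j T, Finset.insert_erase hj⟩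
    rw [wedge_apply_insert hjU]
    by_cases hi : i ∈ U
    · rw [contract_apply_of_mem (Finset.mem_insert_of_mem hi), contract_apply_of_mem hi,
        smul_zero, neg_zero]
    · rw [contract_apply_of_notMem (by simp [hij, hi]), Finset.insert_comm,
        wedge_apply_insert (by simp [hij.symm, hjU]), contract_apply_of_notMem hi, smul_smul,
        smul_smul, sign_insert_mul_sign_insert hij hi hjU, neg_smul]
  · rw [wedge_apply_of_notMem hj, neg_zero]
    by_cases hi : i ∈ T
    · rw [contract_apply_of_mem hi]
    · rw [contract_apply_of_notMem hi, wedge_apply_of_notMem (by simp [hij.symm, hj]), smul_zero]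

lemma contract_compLeft (φ : Module.End R V) (i : ι) (f : Finset ι → V) :
    contract R V i (φ.compLeft (Finset ι) f) = φ.compLeft (Finset ι) (contract R V i f) := by
  funext T
  by_cases hi : i ∈ T
  · simp [contract_apply_of_mem hi]
  · simp [contract_apply_of_notMem hi]

lemma wedge_compLeft (φ : Module.End R V) (i : ι) (f : Finset ι → V) :
    wedge R V i (φ.compLeft (Finset ι) f) = φ.compLeft (Finset ι) (wedge R V i f) := by
  funext T
  by_cases hi : i ∈ T <;> simp [wedge, hi]

lemma single_empty_mem_supportedOn (s : Finset ι) (v : V) :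
    Pi.single ∅ v ∈ supportedOn R V s := by
  refine mem_supportedOn.2 fun T hT => Pi.single_eq_of_ne (M := fun _ => V) ?_ v
  rintro rfl
  exact hT (Finset.empty_subset s)

lemma contract_mem_supportedOn {a : ι} {s : Finset ι} {f : Finset ι → V}
    (hf : f ∈ supportedOn R V (insert a s)) : contract R V a f ∈ supportedOn R V s := by
  refine mem_supportedOn.2 fun T hT => ?_
  by_cases ha : a ∈ T
  · exact contract_apply_of_mem ha f
  · rw [contract_apply_of_notMem ha, mem_supportedOn.1 hf, smul_zero]
    rwa [Finset.insert_subset_insert_iff ha]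

lemma wedge_mem_supportedOn {a : ι} {s : Finset ι} {f : Finset ι → V}
    (hf : f ∈ supportedOn R V s) : wedge R V a f ∈ supportedOn R V (insert a s) := by
  refine mem_supportedOn.2 fun T hT => ?_
  by_cases ha : a ∈ T
  · obtain ⟨U, haU, rfl⟩ : ∃ U, a ∉ U ∧ insert a U = T :=
      ⟨T.erase a, Finset.notMem_erase a T, Finset.insert_erase ha⟩
    rw [wedge_apply_insert haU, mem_supportedOn.1 hf, smul_zero]
    rwa [← Finset.insert_subset_insert_iff haU]
  · exact wedge_apply_of_notMem ha f

lemma contract_eq_zero_of_mem_supportedOn {a : ι} {s : Finset ι} (ha : a ∉ s) {f : Finset ι → V}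
    (hf : f ∈ supportedOn R V s) : contract R V a f = 0 := by
  funext T
  by_cases haT : a ∈ T
  · exact contract_apply_of_mem haT f
  · rw [contract_apply_of_notMem haT, mem_supportedOn.1 hf, smul_zero, Pi.zero_apply]
    exact fun h => ha (h (Finset.mem_insert_self a T))

/-! ### The Koszul differential -/

/-- The differential of the Koszul complex `Λ(R^s) ⊗ V` of the family `(ℓ_i)_{i ∈ s}`, on all of
`Λ(R^ι) ⊗ V` and without its grading. -/
def diff (ℓ : ι → Module.End R V) (s : Finset ι) : Module.End R (Finset ι → V) :=
  ∑ i ∈ s, (ℓ i).compLeft (Finset ι) ∘ₗ contract R V i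

lemma diff_eq_sum (ℓ : ι → Module.End R V) (s : Finset ι) (f : Finset ι → V) :
    diff ℓ s f = ∑ i ∈ s, (ℓ i).compLeft (Finset ι) (contract R V i f) := by
  simp [diff, LinearMap.sum_apply]

lemma diff_apply (ℓ : ι → Module.End R V) (s : Finset ι) (f : Finset ι → V) (T : Finset ι) :
    diff ℓ s f T = ∑ i ∈ s, ℓ i (contract R V i f T) := by
  simp [diff_eq_sum, Finset.sum_apply]

lemma diff_insert (ℓ : ι → Module.End R V) {a : ι} {s : Finset ι} (ha : a ∉ s)
    (f : Finset ι → V) :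
    diff ℓ (insert a s) f = (ℓ a).compLeft (Finset ι) (contract R V a f) + diff ℓ s f := by
  rw [diff_eq_sum, Finset.sum_insert ha, diff_eq_sum]

lemma diff_apply_mem_sumRange (ℓ : ι → Module.End R V) (s : Finset ι) (f : Finset ι → V)
    (T : Finset ι) : diff ℓ s f T ∈ sumRange ℓ s := by
  rw [diff_apply]
  exact Submodule.sum_mem _ fun i hi => apply_mem_sumRange ℓ hi _

lemma contract_diff (ℓ : ι → Module.End R V) (s : Finset ι) (a : ι) (f : Finset ι → V) :
    contract R V a (diff ℓ s f) = -diff ℓ s (contract R V a f) := by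
  simp only [diff_eq_sum, map_sum, contract_compLeft, contract_contract a, map_neg,
    Finset.sum_neg_distrib]

lemma diff_wedge (ℓ : ι → Module.End R V) {a : ι} {s : Finset ι} (ha : a ∉ s)
    (f : Finset ι → V) : diff ℓ s (wedge R V a f) = -wedge R V a (diff ℓ s f) := by
  simp only [diff_eq_sum, map_sum, wedge_compLeft, ← Finset.sum_neg_distrib]
  refine Finset.sum_congr rfl fun i hi => ?_
  rw [contract_wedge_of_ne (ne_of_mem_of_not_mem hi ha), map_neg]

lemma diff_compLeft {ℓ : ι → Module.End R V} {φ : Module.End R V} (hφ : ∀ i, Commute φ (ℓ i))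
    (s : Finset ι) (f : Finset ι → V) :
    diff ℓ s (φ.compLeft (Finset ι) f) = φ.compLeft (Finset ι) (diff ℓ s f) := by
  simp only [diff_eq_sum, map_sum, contract_compLeft]
  refine Finset.sum_congr rfl fun i _ => funext fun T => ?_
  exact (LinearMap.congr_fun (hφ i) (contract R V i f T)).symm

lemma diff_diff {ℓ : ι → Module.End R V} (hℓ : ∀ i j, Commute (ℓ i) (ℓ j)) (s : Finset ι)
    (f : Finset ι → V) : diff ℓ s (diff ℓ s f) = 0 := by
  induction s using Finset.induction_on with
  | empty => simp [diff]
  | insert a s ha ih =>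
    simp only [diff_insert ℓ ha, map_add, contract_compLeft, contract_contract_self, contract_diff,
      diff_compLeft (hℓ a), ih, map_neg, map_zero, zero_add, add_zero, neg_add_cancel]

lemma diff_of_diff_insert_eq_zero {ℓ : ι → Module.End R V} {a : ι} {s : Finset ι} (ha : a ∉ s)
    {f : Finset ι → V} (hf : diff ℓ (insert a s) f = 0) :
    diff ℓ s f = -(ℓ a).compLeft (Finset ι) (contract R V a f) := by
  rwa [diff_insert ℓ ha, add_comm, add_eq_zero_iff_eq_neg] at hf

lemma diff_contract_of_diff_insert_eq_zero {ℓ : ι → Module.End R V} {a : ι} {s : Finset ι}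
    (ha : a ∉ s) {f : Finset ι → V} (hf : diff ℓ (insert a s) f = 0) :
    diff ℓ s (contract R V a f) = 0 := by
  rw [← neg_eq_zero, ← contract_diff, diff_of_diff_insert_eq_zero ha hf, map_neg,
    contract_compLeft, contract_contract_self, map_zero, neg_zero]

lemma diff_contract_wedge_of_diff_insert_eq_zero {ℓ : ι → Module.End R V} {a : ι} {s : Finset ι}
    (ha : a ∉ s) {f : Finset ι → V} (hf : diff ℓ (insert a s) f = 0) :
    diff ℓ s (contract R V a (wedge R V a f)) =
      -(ℓ a).compLeft (Finset ι) (contract R V a f) := by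
  rw [← neg_eq_iff_eq_neg, ← contract_diff, diff_wedge ℓ ha, diff_of_diff_insert_eq_zero ha hf,
    map_neg, map_neg, map_neg, neg_neg, wedge_compLeft, contract_compLeft,
    contract_wedge_of_contract_eq_zero (contract_contract_self a f)]

lemma diff_insert_sub_wedge {ℓ : ι → Module.End R V} {a : ι} {s : Finset ι} (ha : a ∉ s)
    {k h : Finset ι → V} (hk : k ∈ supportedOn R V s) (hh : h ∈ supportedOn R V s) :
    diff ℓ (insert a s) (k - wedge R V a h) =
      diff ℓ s k - (ℓ a).compLeft (Finset ι) h + wedge R V a (diff ℓ s h) := by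
  rw [diff_insert ℓ ha, map_sub (contract R V a), contract_eq_zero_of_mem_supportedOn ha hk,
    contract_wedge_of_contract_eq_zero (contract_eq_zero_of_mem_supportedOn ha hh), zero_sub,
    map_neg, map_sub, diff_wedge ℓ ha]
  abel

lemma diff_single_empty (ℓ : ι → Module.End R V) (s : Finset ι) (v : V) :
    diff ℓ s (Pi.single ∅ v) = 0 := by
  rw [diff_eq_sum]
  refine Finset.sum_eq_zero fun i _ => ?_
  rw [contract_eq_zero_of_mem_supportedOn (Finset.notMem_empty i)
    (single_empty_mem_supportedOn ∅ v), map_zero]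

lemma diff_single_singleton_apply_empty (ℓ : ι → Module.End R V) {s : Finset ι} {i : ι}
    (hi : i ∈ s) (v : V) : diff ℓ s (Pi.single {i} v) ∅ = ℓ i v := by
  rw [diff_apply, Finset.sum_eq_single_of_mem i hi fun j _ hji => ?_]
  · simp [contract_apply_of_notMem, sign]
  · rw [contract_apply_of_notMem (Finset.notMem_empty j),
      Pi.single_eq_of_ne (M := fun _ => V) (by simpa using hji), smul_zero, map_zero]

lemma diff_apply_congr (ℓ : ι → Module.End R V) (s : Finset ι) {f g : Finset ι → V}
    {T : Finset ι} (hfg : ∀ U : Finset ι, U.card = T.card + 1 → f U = g U) :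
    diff ℓ s f T = diff ℓ s g T := by
  rw [diff_apply, diff_apply]
  refine Finset.sum_congr rfl fun i _ => congrArg (ℓ i) ?_
  by_cases hi : i ∈ T
  · rw [contract_apply_of_mem hi, contract_apply_of_mem hi]
  · rw [contract_apply_of_notMem hi, contract_apply_of_notMem hi,
      hfg _ (Finset.card_insert_of_notMem hi)]

/-! ### Exactness for regular families -/

/-- The augmented Koszul complex `Λ(R^s) ⊗ V → V / ∑_{i ∈ s} ℓ_i(V) → 0` of the family
`(ℓ_i)_{i ∈ s}` is exact: a cycle whose component in degree zero is killed by the augmentation is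
a boundary. -/
def IsAcyclic (ℓ : ι → Module.End R V) (s : Finset ι) : Prop :=
  ∀ f ∈ supportedOn R V s, diff ℓ s f = 0 → f ∅ ∈ sumRange ℓ s →
    ∃ g ∈ supportedOn R V s, diff ℓ s g = f

lemma IsAcyclic.exists_diff_eq_and_apply_empty_eq {ℓ : ι → Module.End R V} {s : Finset ι}
    (hs : IsAcyclic ℓ s) {f : Finset ι → V} (hf : f ∈ supportedOn R V s)
    (hdf : diff ℓ s f = 0) (hf₀ : f ∅ ∈ sumRange ℓ s) (v : V) :
    ∃ g ∈ supportedOn R V s, diff ℓ s g = f ∧ g ∅ = v := by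
  obtain ⟨g, hg, hdg⟩ := hs f hf hdf hf₀
  refine ⟨g + Pi.single ∅ (v - g ∅), add_mem hg (single_empty_mem_supportedOn s _), ?_, by simp⟩
  rw [map_add, diff_single_empty, add_zero, hdg]

protected lemma IsAcyclic.empty (ℓ : ι → Module.End R V) : IsAcyclic ℓ ∅ := by
  intro f hf _ hf₀
  refine ⟨0, zero_mem _, ?_⟩
  rw [map_zero]
  funext T
  obtain rfl | hT := T.eq_empty_or_nonempty
  · simpa [sumRange, eq_comm] using hf₀
  · exact (mem_supportedOn.1 hf T fun h => hT.ne_empty (Finset.subset_empty.1 h)).symm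

protected lemma IsAcyclic.insert {ℓ : ι → Module.End R V} (hℓ : ∀ i j, Commute (ℓ i) (ℓ j))
    {a : ι} {s : Finset ι} (ha : a ∉ s) (hs : IsAcyclic ℓ s)
    (hreg : ∀ v, ℓ a v ∈ sumRange ℓ s → v ∈ sumRange ℓ s) : IsAcyclic ℓ (insert a s) := by
  intro f hf hdf hf₀
  have hsf := diff_of_diff_insert_eq_zero ha hdf
  have hcf₀ : contract R V a f ∅ ∈ sumRange ℓ s := by
    refine hreg _ ((Submodule.neg_mem_iff _).1 ?_)
    simpa [hsf] using diff_apply_mem_sumRange ℓ s f ∅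
  obtain ⟨v, u, hu, huv⟩ : ∃ v, ∃ u ∈ sumRange ℓ s, ℓ a v + u = f ∅ := by
    simpa [sumRange_insert, Submodule.mem_sup] using hf₀
  obtain ⟨h, hh, hdh, hh₀⟩ := hs.exists_diff_eq_and_apply_empty_eq
    (contract_mem_supportedOn hf) (diff_contract_of_diff_insert_eq_zero ha hdf) hcf₀ (-v)
  obtain ⟨k, hk, hdk⟩ : ∃ k ∈ supportedOn R V s,
      diff ℓ s k = contract R V a (wedge R V a f) + (ℓ a).compLeft (Finset ι) h := by
    refine hs _ (add_mem ?_ (compLeft_mem_supportedOn _ hh)) ?_ ?_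
    · exact contract_mem_supportedOn (by simpa using wedge_mem_supportedOn (a := a) hf)
    · rw [map_add, diff_contract_wedge_of_diff_insert_eq_zero ha hdf, diff_compLeft (hℓ a), hdh,
        neg_add_cancel]
    · rw [Pi.add_apply, contract_wedge_apply_of_notMem (Finset.notMem_empty a), ← huv]
      simpa [hh₀] using hu
  refine ⟨k - wedge R V a h, sub_mem (supportedOn_mono (Finset.subset_insert a s) hk)
    (wedge_mem_supportedOn hh), ?_⟩
  calc diff ℓ (insert a s) (k - wedge R V a h)
      = contract R V a (wedge R V a f) + wedge R V a (contract R V a f) := by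
        rw [diff_insert_sub_wedge ha hk hh, hdk, hdh, add_sub_cancel_right]
    _ = f := contract_wedge_add_wedge_contract a f

lemma isAcyclic_of_regular {ℓ : ι → Module.End R V} (hℓ : ∀ i j, Commute (ℓ i) (ℓ j)) (s : Finset ι)
    (hreg : ∀ i ∈ s, ∀ v, ℓ i v ∈ sumRange ℓ {j | j ∈ s ∧ j < i} →
      v ∈ sumRange ℓ {j | j ∈ s ∧ j < i}) : IsAcyclic ℓ s := by
  induction s using Finset.induction_on_max with
  | empty => exact .empty ℓ
  | insert a s ha ih =>
    have has : a ∉ s := fun h => lt_irrefl a (ha a h)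
    have hlt_a : {j | j ∈ insert a s ∧ j < a} = (s : Set ι) := by
      ext j; simp only [Finset.mem_insert]; grind
    refine .insert hℓ has (ih fun i hi => ?_) ?_
    · have hlt_i : {j | j ∈ insert a s ∧ j < i} = {j | j ∈ s ∧ j < i} := by
        ext j; simp only [Finset.mem_insert]; grind
      rw [← hlt_i]
      exact hreg i (Finset.mem_insert_of_mem hi)
    · rw [← hlt_a]
      exact hreg a (Finset.mem_insert_self a s)

end KoszulEnd

/-! ### The Koszul complex of a sequence in the commutant -/

namespace LinFun

open KoszulEnd

variable {R : Type w} [CommRing R] {X : Type u} [Category.{w} X] [EssentiallySmall.{w} X]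
  [Preadditive X] [Linear R X] [MonoidalCategory X] [MonoidalPreadditive X] [MonoidalLinear R X]
  {A : LinFun R X} [MonObj A]

namespace SubMod

variable {M : Mod (LinFun R X) A}

lemma subset_generated {v : X} (S : Set (M.X.El v)) : S ⊆ (generated M S).carrier v :=
  fun _ hm => (Submodule.mem_iInf _).2 fun N => N.2 hm

lemma generated_le {v : X} {S : Set (M.X.El v)} (N : SubMod M) (h : S ⊆ N.carrier v) (x : X) :
    (generated M S).carrier x ≤ N.carrier x :=
  iInf_le (fun N : {N : SubMod M // S ⊆ N.carrier v} => N.1.carrier x) ⟨N, h⟩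

lemma mkQ_eq_zero (N : SubMod M) {x : X} {m : M.X.El x} : N.mkQ x m = 0 ↔ m ∈ N.carrier x :=
  Submodule.Quotient.mk_eq_zero (N.carrier x)

lemma mp_mem_iff (N : SubMod M) {x y : X} (e : x ≅ y) {m : M.X.El x} :
    M.X.mp e.hom m ∈ N.carrier y ↔ m ∈ N.carrier x := by
  refine ⟨fun h => ?_, fun h => N.mp_mem e.hom h⟩
  simpa only [← mp_comp, Iso.hom_inv_id, mp_id] using N.mp_mem e.inv h

end SubMod

variable [SymmetricCategory X]

lemma mulLeft_apply (a : commutant A (𝟙_ X)) {x : X} (b : A.El x) :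
    mev (mulLeft a) x b = A.mp (λ_ x).hom (mulE a.1 b) := rfl

lemma mulLeft_comm (a b : commutant A (𝟙_ X)) {x : X} (c : A.El x) :
    mev (mulLeft a) x (mev (mulLeft b) x c) = mev (mulLeft b) x (mev (mulLeft a) x c) := by
  have hact : mev (mulLeft a) (𝟙_ X ⊗ x) (mulE b.1 c) = mulE b.1 (mev (mulLeft a) x c) :=
    mev_act (M := regMod A) (N := regMod A) (mulLeft a) b.1 c
  rw [mulLeft_apply b c, mulLeft_apply b (mev (mulLeft a) x c), ← hact]
  exact mev_mp (mulLeft a) (λ_ x).hom (mulE b.1 c)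

lemma mulLeft_one (a : commutant A (𝟙_ X)) : mev (mulLeft a) (𝟙_ X) (oneE A) = a.1 := by
  have h := a.2 (𝟙_ X) (oneE A)
  rw [← regMod_act, one_act] at h
  have h' := congrArg (A.mp (λ_ (𝟙_ X)).hom) h
  rw [← mp_comp, ← mp_comp, Iso.inv_hom_id, mp_id, braiding_tensorUnit_left] at h'
  rw [mulLeft_apply]
  refine Eq.trans (mp_congr A ?_ _) h'.symm
  simp [unitors_equal]

lemma SubMod.mulLeft_mem {N : SubMod (regMod A)} {a : commutant A (𝟙_ X)}
    (ha : a.1 ∈ N.carrier (𝟙_ X)) {x : X} (b : A.El x) : mev (mulLeft a) x b ∈ N.carrier x := by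
  have h := N.act_mem b ha
  rw [regMod_act, a.2 x b] at h
  exact N.mp_mem (λ_ x).hom ((N.mp_mem_iff (β_ (𝟙_ X) x)).1 h)

lemma IsRegularOn.mem_of_mulLeft_mem {N : SubMod (regMod A)} {a : commutant A (𝟙_ X)}
    (ha : IsRegularOn N.quot a) {x : X} {b : A.El x} (hb : mev (mulLeft a) x b ∈ N.carrier x) :
    b ∈ N.carrier x := by
  by_contra hne
  refine ha x (N.mkQ x b) (fun h => hne (N.mkQ_eq_zero.1 h)) ?_
  refine (mev_act N.proj a.1 (M := regMod A) b).symm.trans ?_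
  exact N.mkQ_eq_zero.2 ((N.mp_mem_iff (λ_ x)).1 hb)

variable {n : ℕ} (α : Fin n → commutant A (𝟙_ X))

/-- The endomorphisms `L_{α_i}` of the `R`-module `A(x)`. -/
noncomputable def mulEnd (x : X) (i : Fin n) : Module.End R (A.El x) := mev (mulLeft (α i)) x

lemma mulEnd_commute (x : X) (i j : Fin n) : Commute (mulEnd α x i) (mulEnd α x j) :=
  LinearMap.ext fun c => mulLeft_comm (α i) (α j) c

/-- The submodule `x ↦ ∑_{i ∈ I} L_{α_i} A(x)` of `A`; by `spanSub_carrier` it is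
`A⟨α_i, i ∈ I⟩`. -/
noncomputable def sumSub (I : Set (Fin n)) : SubMod (regMod A) where
  carrier x := sumRange (mulEnd α x) I
  mp_mem f _ := map_mem_sumRange (A.mp f) fun i b => (mev_mp (mulLeft (α i)) f b).symm
  act_mem {_ z} a _ := map_mem_sumRange (actLin (M := regMod A) a z) fun i b =>
    (mev_act (mulLeft (α i)) a b).symm

lemma spanSub_carrier (I : Set (Fin n)) (x : X) :
    (spanSub α I).carrier x = sumRange (mulEnd α x) I := by
  refine le_antisymm (SubMod.generated_le (sumSub α I) ?_ x) (iSup₂_le fun i hi => ?_)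
  · rintro _ ⟨i, hi, rfl⟩
    have h := apply_mem_sumRange (mulEnd α (𝟙_ X)) hi (oneE A)
    rwa [mulEnd, mulLeft_one] at h
  · have hαi := SubMod.subset_generated (M := regMod A) (v := 𝟙_ X) _ (Set.mem_image_of_mem
      (fun i => (α i : A.El (𝟙_ X))) hi)
    rintro _ ⟨b, rfl⟩
    exact SubMod.mulLeft_mem hαi b

variable {α} in
lemma isAcyclic_mulEnd (hα : ∀ i, IsRegularOn (spanSub α {j | j < i}).quot (α i)) (x : X) :
    IsAcyclic (mulEnd α x) Finset.univ := by
  refine isAcyclic_of_regular (mulEnd_commute α x) Finset.univ fun i _ b hb => ?_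
  simp only [Finset.mem_univ, true_and, ← spanSub_carrier] at hb ⊢
  exact (hα i).mem_of_mulLeft_mem hb

lemma koszulD_apply (p : ℕ) {x : X} (b : KIdx n (p + 1) → A.El x) (T : KIdx n p) :
    (mev (koszulD α p) x b : KIdx n p → A.El x) T = ∑ S : KIdx n (p + 1), ∑ i : S.1,
      if T = S.erase i then sign R i.1 S.1 • mulEnd α x i (b S) else 0 := by
  have hproj (c : (koszul A n (p + 1)).X.El x) :
      mev (powProj (regMod A) T) x (koszulDEl α p x c) =
        ∑ S : KIdx n (p + 1), ∑ i : S.1, (-1 : R) ^ S.pos i • mev (powProj (regMod A) T) x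
          (mev (powProj (regMod A) S ≫ mulLeft (α i) ≫ powIncl (regMod A) (S.erase i)) x c) := by
    simp only [koszulDEl, LinearMap.sum_apply, LinearMap.smul_apply, map_sum, map_smul]
  refine (hproj b).trans (Finset.sum_congr rfl fun S _ => Finset.sum_congr rfl fun i _ => ?_)
  change sign R i.1 S.1 • (Pi.single (S.erase i) (mulEnd α x i (b S)) : KIdx n p → A.El x) T = _
  rw [Pi.single_apply, smul_ite, smul_zero]

lemma koszulD_restrict (p : ℕ) {x : X} (g : Finset (Fin n) → A.El x) :
    mev (koszulD α p) x (fun S : KIdx n (p + 1) => g S.1) =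
      fun T : KIdx n p => diff (mulEnd α x) Finset.univ g T.1 := by
  funext T
  have herase (S : KIdx n (p + 1)) : (∑ i : S.1,
      if T = S.erase i then sign R i.1 S.1 • mulEnd α x i (g S.1) else 0) =
        ∑ i : Fin n, if i ∈ S.1 ∧ S.1.erase i = T.1 then
          sign R i S.1 • mulEnd α x i (g S.1) else 0 := by
    simp_rw [ite_and]
    rw [Finset.sum_ite_mem, Finset.univ_inter, ← Finset.sum_coe_sort S.1]
    exact Finset.sum_congr rfl fun i _ => if_congr (by rw [Subtype.ext_iff, eq_comm]; rfl) rfl rfl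
  refine (koszulD_apply α p _ T).trans ?_
  rw [Finset.sum_congr rfl fun S _ => herase S, Finset.sum_comm, diff_apply]
  refine Finset.sum_congr rfl fun i _ => ?_
  by_cases hi : i ∈ T.1
  · rw [contract_apply_of_mem hi, map_zero]
    exact Finset.sum_eq_zero fun S _ => if_neg fun h : i ∈ S.1 ∧ S.1.erase i = T.1 =>
      Finset.notMem_erase i S.1 (h.2 ▸ hi)
  · have hcard : (insert i T.1).card = p + 1 := by rw [Finset.card_insert_of_notMem hi, T.2]
    rw [contract_apply_of_notMem hi, map_smul, ← sign_insert_self]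
    refine (Fintype.sum_eq_single (⟨insert i T.1, hcard⟩ : KIdx n (p + 1)) fun S hS => ?_).trans ?_
    · refine if_neg fun h => hS (Subtype.ext ?_)
      exact (Finset.insert_erase h.1).symm.trans (congrArg (insert i) h.2)
    · exact if_pos ⟨Finset.mem_insert_self i T.1, Finset.erase_insert hi⟩

lemma koszulD_koszulD (p : ℕ) {x : X} (b : KIdx n (p + 2) → A.El x) :
    mev (koszulD α p) x (mev (koszulD α (p + 1)) x b) = 0 := by
  obtain ⟨g, rfl⟩ : ∃ g : Finset (Fin n) → A.El x, (fun S => g S.1) = b :=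
    Subtype.val_injective.surjective_comp_right b
  rw [koszulD_restrict, koszulD_restrict, diff_diff (mulEnd_commute α x)]
  rfl

lemma exists_diff_eq_zero_of_koszulD_eq_zero {p : ℕ} {x : X} {b : KIdx n (p + 1) → A.El x}
    (hb : mev (koszulD α p) x b = 0) : ∃ f : Finset (Fin n) → A.El x,
      (fun S => f S.1) = b ∧ f ∅ = 0 ∧ diff (mulEnd α x) Finset.univ f = 0 := by
  let f : Finset (Fin n) → A.El x := Function.extend Subtype.val b 0
  have hfb : (fun S => f S.1) = b := Function.extend_comp Subtype.val_injective b 0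
  have hf (U : Finset (Fin n)) (hU : U.card ≠ p + 1) : f U = 0 :=
    Function.extend_apply' _ _ _ fun ⟨S, hS⟩ => hU (hS ▸ S.2)
  refine ⟨f, hfb, hf ∅ (by simp), funext fun T => ?_⟩
  by_cases hT : T.card = p
  · rw [← hfb, koszulD_restrict] at hb
    exact congrFun hb ⟨T, hT⟩
  · rw [diff_apply_congr (g := 0) _ _ fun U hU => hf U (by lia), map_zero]

variable {α} in
lemma modExact_koszulD (hα : ∀ i, IsRegularOn (spanSub α {j | j < i}).quot (α i)) (p : ℕ) :
    ModExact (koszulD α (p + 1)) (koszulD α p) := by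
  intro x (b : KIdx n (p + 1) → A.El x)
  constructor
  · intro hb
    obtain ⟨f, rfl, hf₀, hdf⟩ := exists_diff_eq_zero_of_koszulD_eq_zero α hb
    have hf : f ∈ supportedOn R (A.El x) Finset.univ :=
      mem_supportedOn.2 fun T hT => absurd (Finset.subset_univ T) hT
    obtain ⟨g, -, rfl⟩ := isAcyclic_mulEnd hα x f hf hdf (hf₀ ▸ zero_mem _)
    exact ⟨fun S => g S.1, koszulD_restrict α (p + 1) g⟩
  · rintro ⟨c, rfl⟩
    exact koszulD_koszulD α p c

variable {α} in
lemma koszulD_injective (hα : ∀ i, IsRegularOn (spanSub α {j | j < i}).quot (α i)) {p : ℕ}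
    (hp : n ≤ p + 1) (x : X) : Function.Injective (mev (koszulD α p) x) := by
  rw [injective_iff_map_eq_zero]
  intro b hb
  obtain ⟨c, rfl⟩ := (modExact_koszulD hα p x b).1 hb
  have : IsEmpty (KIdx n (p + 2)) := ⟨fun S => by
    have := S.1.card_le_univ
    rw [S.2, Fintype.card_fin] at this
    omega⟩
  have hc : c = 0 := Subsingleton.elim (α := KIdx n (p + 2) → A.El x) c 0
  rw [hc, map_zero]

lemma range_koszulL (x : X) :
    LinearMap.range (mev (koszulL α) x) = sumRange (mulEnd α x) Set.univ := by
  have hL : ∀ g : Finset (Fin n) → A.El x, mev (koszulL α) x (fun S : KIdx n 1 => g S.1) =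
      diff (mulEnd α x) Finset.univ g ∅ := fun g =>
    congrFun (koszulD_restrict α 0 g) ⟨∅, Finset.card_empty⟩
  refine le_antisymm ?_ (iSup₂_le fun i _ => ?_)
  · rintro _ ⟨(b : KIdx n 1 → A.El x), rfl⟩
    obtain ⟨g, rfl⟩ : ∃ g : Finset (Fin n) → A.El x, (fun S => g S.1) = b :=
      Subtype.val_injective.surjective_comp_right b
    rw [hL, ← Finset.coe_univ]
    exact diff_apply_mem_sumRange _ _ g ∅
  · rintro _ ⟨b, rfl⟩
    refine ⟨fun S : KIdx n 1 => (Pi.single {i} b : Finset (Fin n) → A.El x) S.1, ?_⟩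
    rw [hL, diff_single_singleton_apply_empty _ (Finset.mem_univ i)]

lemma modExact_koszulL_proj : ModExact (koszulL α) (spanSub α Set.univ).proj := by
  intro x b
  rw [← LinearMap.coe_range, range_koszulL, ← spanSub_carrier]
  exact SubMod.mkQ_eq_zero _

end LinFun

theorem theorem3p3 {R : Type w} [CommRing R] {X : Type u} [Category.{w} X]
    [EssentiallySmall.{w} X] [Preadditive X] [Linear R X] [MonoidalCategory X]
    [MonoidalPreadditive X] [MonoidalLinear R X] [SymmetricCategory X]
    (A : LinFun R X) [MonObj A] {n : ℕ} (α : Fin n → LinFun.commutant A (𝟙_ X))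
    (hα : LinFun.IsRegularSeq α) :
    (∀ p : ℕ, p + 1 = n → ∀ x : X, Function.Injective (LinFun.mev (LinFun.koszulD α p) x)) ∧
    (∀ p : ℕ, LinFun.ModExact (LinFun.koszulD α (p + 1)) (LinFun.koszulD α p)) ∧
    LinFun.ModExact (LinFun.koszulL α) (LinFun.spanSub α Set.univ).proj ∧
    (∀ x : X, Function.Surjective (LinFun.mev (LinFun.spanSub α Set.univ).proj x)) :=
  ⟨fun _ hp => LinFun.koszulD_injective hα.regular hp.ge,
    LinFun.modExact_koszulD hα.regular,
    LinFun.modExact_koszulL_proj α,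
    LinFun.SubMod.mkQ_surjective _⟩
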